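/- Let $R$ be a discrete valuation ring with maximal ideal $\mathfrak m$ and residue field of finite cardinality $q$. Let $\mathrm{Hall}(R)$ be the Hall algebra of the category of finite $R$-modules: the free abelian group on the isomorphism classes $[M]$ of finite $R$-modules, with the unital associative multiplication $$[N]\cdot[L]=\sum_{[M]} g^{M}_{N,L}\,[M],$$ where $g^M_{N,L}$ is the number of submodules $A\subset M$ with $A\cong L$ and $M/A\cong N$. For a partition $\mu=(\mu_1\ge\mu_2\ge\cdots)$ let $u_\mu=\left[\bigoplus_i R/\mathfrak m^{\mu_i}\right]$; in particular, $u_{(1^r)}=[(R/\mathfrak m)^r]$. Let $\lambda$ be a partition of length $s$. Then there are unique integers $b_{\lambda\mu}$, indexed by the partitions $\mu$ and zero for all but finitely many $\mu$, with $$u_{(1^{\lambda_1})}u_{(1^{\lambda_2})}\cdots u_{(1^{\lambda_s})}=\sum_\mu b_{\lambda\mu}\,u_\mu ,$$ and for every partition $\mu$ $$b_{\lambda\mu}=\sum_A q^{d(A)},$$ where $A$ ranges over all row-strict arrays of shape $\mu$ and weight $\lambda$. Here an array of shape $\mu$ and weight $\lambda$ is a map $A$ from the diagram $\{(i,j): i\ge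 1,\ 1\le j\le\mu_i\}$ of $\mu$ to the positive integers which takes each value $k$ exactly $\lambda_k$ times; it is extended by $A(x)=\infty$ for $x\in\mathbb N^+\times\mathbb N^+$ outside the diagram. With $x^{\to}=(i,j+1)$ for $x=(i,j)$, the array is row-strict if $A(x)<A(x^{\to})$ for every $x$ in the diagram. Order the pairs by $(i,j)<(i',j')$ if and only if $j<j'$, or $j=j'$ and $i>i'$. Then $d(A)$, Zelevinsky's statistic, is the number of pairs $(x,y)$ of elements of the diagram of $\mu$ with $y<x$ and $A(x)<A(y)<A(x^{\to})$. -/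

import Mathlib

universe u

namespace HallAlg

/-! ### Isomorphism classes of finite modules -/

section Classes

variable (R : Type u) [CommRing R]

/-- The modules over `R` whose underlying set is finite. -/
def FinMod : Type (u + 1) := {M : ModuleCat.{u} R // Finite M}

instance (M : FinMod R) : Finite M.1 := M.2

/-- Isomorphism of finite modules, as an equivalence relation. -/
instance isoSetoid : Setoid (FinMod R) where
  r M N := Nonempty (M.1 ≃ₗ[R] N.1)
  iseqv :=
    { refl := fun M => ⟨LinearEquiv.refl R M.1⟩
      symm := fun ⟨e⟩ => ⟨e.symm⟩
      trans := fun ⟨e⟩ ⟨f⟩ => ⟨e.trans f⟩ }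

/-- The set of isomorphism classes of finite `R`-modules. -/
def IsoClass : Type (u + 1) := Quotient (isoSetoid R)

/-- The isomorphism class `[M]` of a finite module `M`. -/
def cls (M : Type u) [AddCommGroup M] [Module R M] [Finite M] : IsoClass R :=
  Quotient.mk (isoSetoid R) ⟨ModuleCat.of R M, inferInstanceAs (Finite M)⟩

theorem cls_eq_iff {M N : Type u} [AddCommGroup M] [Module R M] [Finite M]
    [AddCommGroup N] [Module R N] [Finite N] :
    cls R M = cls R N ↔ Nonempty (M ≃ₗ[R] N) :=
  Quotient.eq (r := isoSetoid R)

theorem cls_congr {M N : Type u} [AddCommGroup M] [Module R M] [Finite M]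
    [AddCommGroup N] [Module R N] [Finite N] (e : M ≃ₗ[R] N) : cls R M = cls R N :=
  (cls_eq_iff R).2 ⟨e⟩

theorem cls_out (X : IsoClass R) : cls R (Quotient.out X).1 = X :=
  Quotient.out_eq X

instance finiteQuotient {M : Type u} [AddCommGroup M] [Module R M] [Finite M]
    (A : Submodule R M) : Finite (M ⧸ A) :=
  Finite.of_surjective _ A.mkQ_surjective

/-- For isomorphism classes `N`, `L` and a finite module `M`: the number of submodules `A` of `M`
with `A ≅ L` and `M / A ≅ N`. -/
noncomputable def hallCount (N L : IsoClass R) (M : Type u) [AddCommGroup M] [Module R M]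
    [Finite M] : ℕ :=
  Nat.card {A : Submodule R M // cls R (M ⧸ A) = N ∧ cls R A = L}

theorem hallCount_congr (N L : IsoClass R) {M M' : Type u} [AddCommGroup M] [Module R M] [Finite M]
    [AddCommGroup M'] [Module R M'] [Finite M'] (e : M ≃ₗ[R] M') :
    hallCount R N L M = hallCount R N L M' := by
  refine Nat.card_congr ((Submodule.orderIsoMapComap e).toEquiv.subtypeEquiv fun A => ?_)
  have h1 : cls R (M ⧸ A) = cls R (M' ⧸ A.map (e : M →ₗ[R] M')) :=
    cls_congr R (Submodule.Quotient.equiv A _ e rfl)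
  have h2 : cls R A = cls R (A.map (e : M →ₗ[R] M')) := cls_congr R (e.submoduleMap A)
  rw [h1, h2]
  rfl

/-- The structure constant `g^X_{N,L}` of the Hall algebra, for isomorphism classes `N`, `L`, `X`. -/
noncomputable def hallNumber (N L X : IsoClass R) : ℕ :=
  Quotient.liftOn X (fun M => hallCount R N L M.1) fun _ _ ⟨e⟩ => hallCount_congr R N L e

theorem hallNumber_cls (N L : IsoClass R) (M : Type u) [AddCommGroup M] [Module R M] [Finite M] :
    hallNumber R N L (cls R M) = hallCount R N L M := rfl

/-- The cardinality of the modules in an isomorphism class. -/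
noncomputable def clsCard (X : IsoClass R) : ℕ :=
  Quotient.liftOn X (fun M => Nat.card M.1) fun _ _ ⟨e⟩ => Nat.card_congr e.toEquiv

theorem clsCard_cls (M : Type u) [AddCommGroup M] [Module R M] [Finite M] :
    clsCard R (cls R M) = Nat.card M := rfl

theorem clsCard_of_hallNumber_ne_zero {N L X : IsoClass R} (h : hallNumber R N L X ≠ 0) :
    clsCard R X = clsCard R N * clsCard R L := by
  rw [← cls_out R X, hallNumber_cls, hallCount, Nat.card_ne_zero] at h
  obtain ⟨⟨A, h1, h2⟩⟩ := h.1
  rw [← cls_out R X, ← h1, ← h2, clsCard_cls, clsCard_cls, clsCard_cls, mul_comm]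
  exact A.card_eq_card_quotient_mul_card

end Classes

/-! ### Finiteness over a discrete valuation ring with finite residue field -/

section Finiteness

variable (R : Type u) [CommRing R] [IsDomain R] [IsDiscreteValuationRing R]

theorem pow_maximalIdeal_smul_eq_zero (M : Type u) [AddCommGroup M] [Module R M] [Finite M]
    {r : R} (hr : r ∈ IsLocalRing.maximalIdeal R ^ Nat.card M) (x : M) : r • x = 0 := by
  obtain ⟨p, hp⟩ := IsDiscreteValuationRing.exists_irreducible R
  rw [hp.maximalIdeal_eq, Ideal.span_singleton_pow, Ideal.mem_span_singleton] at hr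
  have key : p ^ Nat.card M • x = 0 := by
    let f : Fin (Nat.card M + 1) → M := fun i => p ^ (i : ℕ) • x
    have hf : ¬ Function.Injective f := fun hinj => by
      have := Nat.card_le_card_of_injective f hinj
      simp at this
    have aux : ∀ i j : Fin (Nat.card M + 1), i < j → f i = f j → p ^ Nat.card M • x = 0 := by
      intro i j hij hfe
      have hij' : (i : ℕ) < j := hij
      have hu : IsUnit (1 - p ^ ((j : ℕ) - i)) := by
        rw [← IsLocalRing.notMem_maximalIdeal]
        intro hmem
        have h2 : p ^ ((j : ℕ) - i) ∈ IsLocalRing.maximalIdeal R :=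
          Ideal.pow_mem_of_mem _ ((IsLocalRing.mem_maximalIdeal p).2 hp.not_isUnit) _ (by omega)
        have h3 := add_mem hmem h2
        rw [sub_add_cancel] at h3
        exact (Ideal.ne_top_iff_one _).1 (IsLocalRing.maximalIdeal.isMaximal R).ne_top h3
      have h0 : (1 - p ^ ((j : ℕ) - i)) • (p ^ (i : ℕ) • x) = 0 := by
        rw [sub_smul, one_smul, smul_smul, ← pow_add, Nat.sub_add_cancel hij'.le]
        exact sub_eq_zero.2 hfe
      have h1 : p ^ (i : ℕ) • x = 0 := by
        obtain ⟨v, hv⟩ := hu.exists_left_inv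
        rw [← one_smul R (p ^ (i : ℕ) • x), ← hv, mul_smul, h0, smul_zero]
      have h2 : Nat.card M = (Nat.card M - i) + i := by have := i.2; omega
      rw [h2, pow_add, mul_smul, h1, smul_zero]
    simp only [Function.Injective, not_forall] at hf
    obtain ⟨i, j, hfe, hne⟩ := hf
    rcases lt_or_gt_of_ne hne with h | h
    · exact aux i j h hfe
    · exact aux j i h hfe.symm
  obtain ⟨s, rfl⟩ := hr
  rw [mul_comm, mul_smul, key, smul_zero]

variable [Finite (IsLocalRing.ResidueField R)]

theorem finite_clsCard_eq (c : ℕ) : {X : IsoClass R | clsCard R X = c}.Finite := by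
  classical
  let I : Ideal R := IsLocalRing.maximalIdeal R ^ c
  have : Finite (R ⧸ IsLocalRing.maximalIdeal R) :=
    inferInstanceAs (Finite (IsLocalRing.ResidueField R))
  have : Finite (R ⧸ I) :=
    Ideal.finite_quotient_pow (IsNoetherian.noetherian (IsLocalRing.maximalIdeal R)) c
  have hc : ∀ X : {X : IsoClass R // clsCard R X = c}, Nat.card (Quotient.out X.1).1 = c := by
    intro X
    rw [← clsCard_cls R, cls_out, X.2]
  let e : ∀ X : {X : IsoClass R // clsCard R X = c}, (Quotient.out X.1).1 ≃ Fin c :=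
    fun X => Finite.equivFinOfCardEq (hc X)
  let F : {X : IsoClass R // clsCard R X = c} →
      (Fin c → Fin c → Fin c) × (R ⧸ I → Fin c → Fin c) := fun X =>
    (fun a b => e X ((e X).symm a + (e X).symm b),
      fun r a => e X ((Quotient.out r : R) • (e X).symm a))
  have hF : Function.Injective F := by
    intro X Y hXY
    have hadd : ∀ a b, e X ((e X).symm a + (e X).symm b) = e Y ((e Y).symm a + (e Y).symm b) :=
      fun a b => congrFun (congrFun (congrArg Prod.fst hXY) a) b
    have hsm : ∀ (r : R ⧸ I) a, e X ((Quotient.out r : R) • (e X).symm a) =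
        e Y ((Quotient.out r : R) • (e Y).symm a) :=
      fun r a => congrFun (congrFun (congrArg Prod.snd hXY) r) a
    have hout : ∀ (Z : {X : IsoClass R // clsCard R X = c}) (r : R) (m : (Quotient.out Z.1).1),
        (Quotient.out (Ideal.Quotient.mk I r) : R) • m = r • m := by
      intro Z r m
      rw [← sub_eq_zero, ← sub_smul]
      refine pow_maximalIdeal_smul_eq_zero R (Quotient.out Z.1).1 ?_ m
      rw [hc Z]
      refine Ideal.Quotient.eq.1 ?_
      exact Quotient.out_eq (s := Submodule.quotientRel I) (Ideal.Quotient.mk I r)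
    apply Subtype.ext
    rw [← cls_out R X.1, ← cls_out R Y.1]
    refine cls_congr R
      { (e X).trans (e Y).symm with
        map_add' := fun m n => ?_
        map_smul' := fun r m => ?_ }
    · have := hadd (e X m) (e X n)
      simp only [Equiv.symm_apply_apply] at this
      simp [this]
    · have := hsm (Ideal.Quotient.mk I r) (e X m)
      simp only [Equiv.symm_apply_apply, hout] at this
      simp [this]
  have : Finite {X : IsoClass R // clsCard R X = c} := Finite.of_injective F hF
  exact Set.finite_coe_iff.1 this

theorem finite_hallNumber_support (N L : IsoClass R) :
    (Function.support fun X : IsoClass R => (hallNumber R N L X : ℤ)).Finite :=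
  (finite_clsCard_eq R (clsCard R N * clsCard R L)).subset fun _ hX =>
    clsCard_of_hallNumber_ne_zero R (Nat.cast_ne_zero.1 hX)

end Finiteness

/-! ### The Hall algebra -/

section FreeGroup

variable (R : Type u) [CommRing R]

/-- The free abelian group on the isomorphism classes of finite `R`-modules. -/
def Hall : Type (u + 1) := IsoClass R →₀ ℤ

noncomputable instance : AddCommGroup (Hall R) := inferInstanceAs (AddCommGroup (IsoClass R →₀ ℤ))

/-- The basis element of the Hall algebra given by an isomorphism class. -/
noncomputable def basisElt (X : IsoClass R) : Hall R := Finsupp.single X 1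

/-- The coefficient of an element of the Hall algebra at an isomorphism class. -/
noncomputable def coeff (X : IsoClass R) : Hall R →+ ℤ := Finsupp.applyAddHom X

/-- The isomorphism classes that occur in an element of the Hall algebra. -/
def supp (a : Hall R) : Finset (IsoClass R) := Finsupp.support a

theorem coeff_ext {a b : Hall R} (h : ∀ X, coeff R X a = coeff R X b) : a = b :=
  Finsupp.ext h

open Classical in
theorem coeff_basisElt (X Y : IsoClass R) :
    coeff R X (basisElt R Y) = if Y = X then 1 else 0 :=
  Finsupp.single_apply

theorem hall_sum_eq (a : Hall R) :
    a = ∑ X ∈ supp R a, coeff R X a • basisElt R X := by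
  have h : (Finsupp.sum a fun X c => Finsupp.single X c) = (a : IsoClass R →₀ ℤ) :=
    Finsupp.sum_single a
  refine h.symm.trans (Finset.sum_congr rfl fun X _ => ?_)
  have h2 : ∀ c : ℤ, (Finsupp.single X c : IsoClass R →₀ ℤ) = c • Finsupp.single X 1 := by simp
  exact h2 _

theorem hall_hom_ext {B : Type*} [AddCommGroup B] {f g : Hall R →+ B}
    (h : ∀ X, f (basisElt R X) = g (basisElt R X)) : f = g := by
  ext a
  rw [hall_sum_eq R a]
  simp only [map_sum, map_zsmul, h]

open Classical in
theorem sum_support_mul {ι : Type*} [Fintype ι] (a : Hall R) (t : ι → IsoClass R) (Q : ι → Prop) :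
    ∑ X ∈ supp R a, coeff R X a * (∑ i, if t i = X ∧ Q i then (1 : ℤ) else 0) =
      ∑ i, if Q i then coeff R (t i) a else 0 := by
  simp_rw [Finset.mul_sum]
  rw [Finset.sum_comm]
  refine Finset.sum_congr rfl fun i _ => ?_
  by_cases hQ : Q i
  · simp only [hQ, and_true, mul_ite, mul_one, mul_zero, if_true]
    rw [Finset.sum_ite_eq]
    split_ifs with h
    · rfl
    · exact (Finsupp.notMem_support_iff.1 h).symm
  · simp [hQ]

instance finiteSubmodule {M : Type u} [AddCommGroup M] [Module R M] [Finite M] :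
    Finite (Submodule R M) :=
  Finite.of_injective (fun A => (A : Set M)) SetLike.coe_injective

noncomputable local instance fintypeSubmodule {M : Type u} [AddCommGroup M] [Module R M]
    [Finite M] : Fintype (Submodule R M) :=
  Fintype.ofFinite _

open Classical in
theorem hallCount_eq_sum (N L : IsoClass R) (M : Type u) [AddCommGroup M] [Module R M] [Finite M] :
    (hallCount R N L M : ℤ) =
      ∑ A : Submodule R M, if cls R (M ⧸ A) = N ∧ cls R A = L then 1 else 0 := by
  rw [hallCount, Nat.card_eq_fintype_card, Fintype.card_subtype, Finset.card_filter]
  push_cast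
  rfl

open Classical in
theorem hallCount_quotient (N L : IsoClass R) (P : Type u) [AddCommGroup P] [Module R P] [Finite P]
    (A : Submodule R P) :
    (hallCount R N L (P ⧸ A) : ℤ) = ∑ B : Submodule R P,
      if A ≤ B ∧ cls R (P ⧸ B) = N ∧ cls R (B ⧸ A.submoduleOf B) = L then 1 else 0 := by
  have key : ∀ C : Submodule R (P ⧸ A), cls R ((P ⧸ A) ⧸ C) = cls R (P ⧸ C.comap A.mkQ) ∧
      cls R C = cls R (C.comap A.mkQ ⧸ A.submoduleOf (C.comap A.mkQ)) := by
    intro C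
    constructor
    · let f : P →ₗ[R] (P ⧸ A) ⧸ C := C.mkQ ∘ₗ A.mkQ
      have hf : Function.Surjective f := C.mkQ_surjective.comp A.mkQ_surjective
      have hk : LinearMap.ker f = C.comap A.mkQ := by
        rw [LinearMap.ker_comp, Submodule.ker_mkQ]
      rw [← hk]
      exact (cls_congr R (f.quotKerEquivOfSurjective hf)).symm
    · let f : C.comap A.mkQ →ₗ[R] C := A.mkQ.restrict fun _ hx => hx
      have hf : Function.Surjective f := by
        rintro ⟨y, hy⟩
        obtain ⟨x, rfl⟩ := A.mkQ_surjective y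
        exact ⟨⟨x, hy⟩, rfl⟩
      have hk : LinearMap.ker f = A.submoduleOf (C.comap A.mkQ) := by
        ext ⟨x, hx⟩
        exact Subtype.ext_iff.trans (Submodule.Quotient.mk_eq_zero A)
      rw [← hk]
      exact (cls_congr R (f.quotKerEquivOfSurjective hf)).symm
  rw [hallCount, ← Finset.natCast_card_filter, Nat.cast_inj, ← Fintype.card_subtype,
    ← Nat.card_eq_fintype_card]
  refine Nat.card_congr
    { toFun := fun C => ⟨C.1.comap A.mkQ, ?_, ?_, ?_⟩
      invFun := fun B => ⟨B.1.map A.mkQ, ?_⟩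
      left_inv := fun C => Subtype.ext (Submodule.map_comap_eq_of_surjective A.mkQ_surjective _)
      right_inv := fun B => Subtype.ext (by simpa [Submodule.comap_map_eq] using B.2.1) }
  · exact fun x hx => by
      rw [Submodule.mem_comap, Submodule.mkQ_apply, (Submodule.Quotient.mk_eq_zero A).2 hx]
      exact C.1.zero_mem
  · rw [← (key C.1).1, C.2.1]
  · rw [← (key C.1).2, C.2.2]
  · have hB : (B.1.map A.mkQ).comap A.mkQ = B.1 := by simpa [Submodule.comap_map_eq] using B.2.1
    obtain ⟨h1, h2⟩ := key (B.1.map A.mkQ)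
    rw [h1, h2, hB]
    exact B.2.2

open Classical in
theorem hallCount_submodule (L K : IsoClass R) (P : Type u) [AddCommGroup P] [Module R P] [Finite P]
    (B : Submodule R P) :
    (hallCount R L K B : ℤ) = ∑ A : Submodule R P,
      if A ≤ B ∧ cls R (B ⧸ A.submoduleOf B) = L ∧ cls R A = K then 1 else 0 := by
  rw [hallCount, ← Finset.natCast_card_filter, Nat.cast_inj, ← Fintype.card_subtype,
    ← Nat.card_eq_fintype_card]
  refine Nat.card_congr
    { toFun := fun A => ⟨A.1.map B.subtype, Submodule.map_subtype_le _ _, ?_, ?_⟩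
      invFun := fun A => ⟨A.1.submoduleOf B, A.2.2.1, ?_⟩
      left_inv := fun A => Subtype.ext
        (Submodule.comap_map_eq_of_injective B.subtype_injective _)
      right_inv := fun A => Subtype.ext (Submodule.map_comap_subtype B A.1 |>.trans
        (inf_eq_right.2 A.2.1)) }
  · have h : (A.1.map B.subtype).submoduleOf B = A.1 :=
      Submodule.comap_map_eq_of_injective B.subtype_injective _
    rw [h, A.2.1]
  · rw [← cls_congr R (Submodule.equivSubtypeMap B A.1), A.2.2]
  · rw [cls_congr R (Submodule.submoduleOfEquivOfLe A.2.1), A.2.2.2]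

end FreeGroup

section Algebra

variable (R : Type u) [CommRing R]
  [IsDomain R] [IsDiscreteValuationRing R] [Finite (IsLocalRing.ResidueField R)]

/-- The product of two basis elements, `[N] [L] = ∑ g^X_{N,L} [X]`. -/
noncomputable def basisMul (N L : IsoClass R) : Hall R :=
  Finsupp.ofSupportFinite (fun X => (hallNumber R N L X : ℤ)) (finite_hallNumber_support R N L)

theorem coeff_basisMul (N L X : IsoClass R) : coeff R X (basisMul R N L) = hallNumber R N L X := rfl

/-- The bilinear extension of the product of basis elements. -/
noncomputable def hallMul : Hall R →+ Hall R →+ Hall R :=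
  Finsupp.liftAddHom fun N => (AddMonoidHom.flip (smulAddHom ℤ (Hall R →+ Hall R))) <|
    Finsupp.liftAddHom fun L => (AddMonoidHom.flip (smulAddHom ℤ (Hall R))) (basisMul R N L)

theorem hallMul_basisElt (N L : IsoClass R) :
    hallMul R (basisElt R N) (basisElt R L) = basisMul R N L := by
  have h1 : hallMul R (basisElt R N) = (1 : ℤ) • (Finsupp.liftAddHom fun L =>
      (AddMonoidHom.flip (smulAddHom ℤ (Hall R))) (basisMul R N L) : (IsoClass R →₀ ℤ) →+ Hall R) :=
    Finsupp.liftAddHom_apply_single _ _ _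
  rw [h1, one_smul]
  exact (Finsupp.liftAddHom_apply_single _ _ _).trans (one_smul ℤ _)

noncomputable local instance fintypeSubmodule' {M : Type u} [AddCommGroup M] [Module R M]
    [Finite M] : Fintype (Submodule R M) :=
  Fintype.ofFinite _

theorem hallMul_assoc_basis (N L K : IsoClass R) :
    hallMul R (hallMul R (basisElt R N) (basisElt R L)) (basisElt R K) =
      hallMul R (basisElt R N) (hallMul R (basisElt R L) (basisElt R K)) := by
  classical
  refine coeff_ext R fun X => ?_
  rw [← cls_out R X]
  generalize (Quotient.out X) = P
  rw [hallMul_basisElt, hallMul_basisElt]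
  conv_lhs => rw [hall_sum_eq R (basisMul R N L)]
  conv_rhs => rw [hall_sum_eq R (basisMul R L K)]
  simp only [map_sum, map_zsmul, AddMonoidHom.finsetSum_apply, AddMonoidHom.smul_apply,
    hallMul_basisElt, smul_eq_mul]
  simp only [coeff_basisMul R _ K, coeff_basisMul R N, hallNumber_cls R _ _ P.1]
  simp only [hallCount_eq_sum R _ _ P.1, and_comm (a := cls R (P.1 ⧸ _) = N)]
  refine (sum_support_mul R (basisMul R N L) (fun A : Submodule R P.1 => cls R (P.1 ⧸ A))
    (fun A => cls R A = K)).trans (Eq.trans ?_ (sum_support_mul R (basisMul R L K)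
      (fun A : Submodule R P.1 => cls R A) (fun A => cls R (P.1 ⧸ A) = N)).symm)
  simp only [coeff_basisMul, hallNumber_cls, hallCount_quotient, hallCount_submodule]
  have hl : ∀ A : Submodule R P.1, (if cls R A = K then ∑ B : Submodule R P.1,
      if A ≤ B ∧ cls R (P.1 ⧸ B) = N ∧ cls R (B ⧸ A.submoduleOf B) = L then (1 : ℤ) else 0 else 0) =
      ∑ B : Submodule R P.1, if A ≤ B ∧ cls R (P.1 ⧸ B) = N ∧ cls R (B ⧸ A.submoduleOf B) = L ∧
        cls R A = K then (1 : ℤ) else 0 := by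
    intro A
    by_cases h : cls R A = K <;> simp [h]
  have hr : ∀ B : Submodule R P.1, (if cls R (P.1 ⧸ B) = N then ∑ A : Submodule R P.1,
      if A ≤ B ∧ cls R (B ⧸ A.submoduleOf B) = L ∧ cls R A = K then (1 : ℤ) else 0 else 0) =
      ∑ A : Submodule R P.1, if A ≤ B ∧ cls R (P.1 ⧸ B) = N ∧ cls R (B ⧸ A.submoduleOf B) = L ∧
        cls R A = K then (1 : ℤ) else 0 := by
    intro B
    by_cases h : cls R (P.1 ⧸ B) = N <;> simp [h]
  exact (Finset.sum_congr rfl fun A _ => hl A).trans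
    (Finset.sum_comm.trans (Finset.sum_congr rfl fun B _ => (hr B).symm))

theorem hallMul_assoc (a b c : Hall R) :
    hallMul R (hallMul R a b) c = hallMul R a (hallMul R b c) := by
  let f : Hall R →+ Hall R →+ Hall R →+ Hall R :=
    { toFun := fun a => (hallMul R).comp (hallMul R a)
      map_zero' := by ext; simp
      map_add' := fun a b => by ext; simp }
  let g : Hall R →+ Hall R →+ Hall R →+ Hall R :=
    { toFun := fun a => (AddMonoidHom.compHom (hallMul R a)).comp (hallMul R)
      map_zero' := by ext; simp
      map_add' := fun a b => by ext; simp }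
  have h : f = g := hall_hom_ext R fun N => hall_hom_ext R fun L => hall_hom_ext R fun K =>
    hallMul_assoc_basis R N L K
  exact DFunLike.congr_fun (DFunLike.congr_fun (DFunLike.congr_fun h a) b) c

theorem basisMul_zero_left (X : IsoClass R) : basisMul R (cls R PUnit) X = basisElt R X := by
  classical
  refine coeff_ext R fun Y => ?_
  rw [coeff_basisMul, coeff_basisElt, ← cls_out R Y]
  generalize (Quotient.out Y) = P
  rw [hallNumber_cls, hallCount_eq_sum, Finset.sum_eq_single ⊤]
  · have h1 : cls R (P.1 ⧸ (⊤ : Submodule R P.1)) = cls R PUnit :=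
      cls_congr R (LinearEquiv.ofSubsingleton _ _)
    have h2 : cls R (⊤ : Submodule R P.1) = cls R P.1 := cls_congr R Submodule.topEquiv
    simp [h1, h2, eq_comm]
  · rintro A - hA
    refine if_neg fun h => hA ?_
    obtain ⟨e⟩ := (cls_eq_iff R).1 h.1
    exact Submodule.Quotient.subsingleton_iff.1 e.toEquiv.subsingleton
  · exact fun h => absurd (Finset.mem_univ _) h

theorem basisMul_zero_right (X : IsoClass R) : basisMul R X (cls R PUnit) = basisElt R X := by
  classical
  refine coeff_ext R fun Y => ?_
  rw [coeff_basisMul, coeff_basisElt, ← cls_out R Y]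
  generalize (Quotient.out Y) = P
  rw [hallNumber_cls, hallCount_eq_sum, Finset.sum_eq_single ⊥]
  · have h1 : cls R (⊥ : Submodule R P.1) = cls R PUnit :=
      cls_congr R (LinearEquiv.ofSubsingleton _ _)
    have h2 : cls R (P.1 ⧸ (⊥ : Submodule R P.1)) = cls R P.1 :=
      cls_congr R (Submodule.quotEquivOfEqBot _ rfl)
    simp [h1, h2, eq_comm]
  · rintro A - hA
    refine if_neg fun h => hA ?_
    obtain ⟨e⟩ := (cls_eq_iff R).1 h.2
    exact Submodule.subsingleton_iff_eq_bot.1 e.toEquiv.subsingleton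
  · exact fun h => absurd (Finset.mem_univ _) h

/-- The Hall algebra of the category of finite `R`-modules: the free abelian group on the isomorphism
classes, with product `[N] [L] = ∑ g^M_{N,L} [M]`, where `g^M_{N,L}` counts the submodules `A` of `M`
with `A ≅ L` and `M / A ≅ N`. -/
noncomputable instance : Ring (Hall R) :=
  { (inferInstance : AddCommGroup (Hall R)) with
    mul := fun a b => hallMul R a b
    one := basisElt R (cls R PUnit)
    zero_mul := fun a => DFunLike.congr_fun (map_zero (hallMul R)) a
    mul_zero := fun a => map_zero (hallMul R a)
    left_distrib := fun a b c => map_add (hallMul R a) b c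
    right_distrib := fun a b c => DFunLike.congr_fun (map_add (hallMul R) a b) c
    mul_assoc := hallMul_assoc R
    one_mul := fun a => DFunLike.congr_fun (hall_hom_ext R
      (f := hallMul R (basisElt R (cls R PUnit))) (g := AddMonoidHom.id _) fun X =>
        (hallMul_basisElt R _ X).trans (basisMul_zero_left R X)) a
    mul_one := fun a => DFunLike.congr_fun (hall_hom_ext R
      (f := (hallMul R).flip (basisElt R (cls R PUnit))) (g := AddMonoidHom.id _) fun X =>
        (hallMul_basisElt R X _).trans (basisMul_zero_right R X)) a
    zsmul := fun n a => n • a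
    zsmul_zero' := fun a => zero_zsmul a
    zsmul_succ' := fun n a => SubNegMonoid.zsmul_succ' n a
    zsmul_neg' := fun n a => SubNegMonoid.zsmul_neg' n a
    nsmul := fun n a => n • a
    nsmul_zero := fun a => zero_nsmul a
    nsmul_succ := fun n a => succ_nsmul a n }

theorem mul_def (a b : Hall R) : a * b = hallMul R a b := rfl

theorem one_def : (1 : Hall R) = basisElt R (cls R PUnit) := rfl

theorem coeff_mul (N L X : IsoClass R) :
    coeff R X (basisElt R N * basisElt R L) = hallNumber R N L X := by
  rw [mul_def, hallMul_basisElt, coeff_basisMul]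

end Algebra

/-! ### The basis elements labelled by partitions

A partition is encoded as a Young diagram `μ`: its parts are `μ.rowLen 0 ≥ μ.rowLen 1 ≥ ⋯`, it has
`μ.colLen 0` nonzero parts, and `μ.rowLens` is the list of these. Rows and columns are numbered from `0`,
and the cell in row `i` and column `j` is the pair `(i, j)`. -/

section Types

variable (R : Type u) [CommRing R] [IsLocalRing R]

/-- The standard module of type `μ`: the direct sum of the modules `R / 𝔪 ^ μ_i`. -/
abbrev TypeModule (μ : YoungDiagram) : Type u :=
  (i : Fin (μ.colLen 0)) → R ⧸ IsLocalRing.maximalIdeal R ^ μ.rowLen i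

instance finite_quotient_pow [IsNoetherianRing R] [Finite (IsLocalRing.ResidueField R)] (n : ℕ) :
    Finite (R ⧸ IsLocalRing.maximalIdeal R ^ n) :=
  have : Finite (R ⧸ IsLocalRing.maximalIdeal R) :=
    inferInstanceAs (Finite (IsLocalRing.ResidueField R))
  Ideal.finite_quotient_pow (IsNoetherian.noetherian (IsLocalRing.maximalIdeal R)) n

/-- The basis element `u_μ` of the Hall algebra: the class of the modules of type `μ`. -/
noncomputable def uElt [IsNoetherianRing R] [Finite (IsLocalRing.ResidueField R)]
    (μ : YoungDiagram) : Hall R :=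
  basisElt R (cls R (TypeModule R μ))

end Types

/-- The partition `(1^r) = (1, …, 1)` with `r` parts. -/
def ones (r : ℕ) : YoungDiagram :=
  YoungDiagram.ofRowLens (List.replicate r 1)
    (List.Pairwise.sortedGE (List.pairwise_replicate.2 (Or.inr (ge_of_eq rfl))))

/-! ### Arrays and the statistic -/

/-- An array of shape `μ`: a labelling of the cells of the diagram by positive integers. -/
abbrev CellArray (μ : YoungDiagram) : Type := μ.cells → ℕ+

variable {μ : YoungDiagram}

/-- The extension of an array to all pairs, with value `∞` outside the diagram. -/
def CellArray.ext (A : CellArray μ) (x : ℕ × ℕ) : WithTop ℕ+ :=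
  if h : x ∈ μ.cells then (A ⟨x, h⟩ : WithTop ℕ+) else ⊤

/-- The right neighbour `x^→ = (i, j + 1)` of `x = (i, j)`. -/
def right (x : ℕ × ℕ) : ℕ × ℕ := (x.1, x.2 + 1)

/-- `A` is row-strict: `A(x^→) > A(x)` for all cells `x`. -/
def CellArray.RowStrict (A : CellArray μ) : Prop := ∀ x : μ.cells, A.ext x < A.ext (right x)

/-- `A` has weight `lam`: the label `k + 1` appears exactly `lam.rowLen k` times, for all `k : ℕ`. -/
def CellArray.HasWeight (A : CellArray μ) (lam : YoungDiagram) : Prop :=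
  ∀ k : ℕ, (Finset.univ.filter fun x : μ.cells => A x = k.succPNat).card = lam.rowLen k

/-- The order on cells: `(i, j) < (i', j')` iff `j < j'`, or `j = j'` and `i > i'`. -/
def CellLT (x y : ℕ × ℕ) : Prop := x.2 < y.2 ∨ x.2 = y.2 ∧ y.1 < x.1

/-- Zelevinsky's statistic: the number of pairs `(x, y)` of cells with `y < x` and
`A(x) < A(y) < A(x^→)`. -/
noncomputable def CellArray.zelevinsky (A : CellArray μ) : ℕ :=
  Nat.card {p : μ.cells × μ.cells //
    CellLT p.2 p.1 ∧ A.ext p.1 < A.ext p.2 ∧ A.ext p.2 < A.ext (right p.1)}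

theorem finite_rowStrictArrays (μ lam : YoungDiagram) :
    {A : CellArray μ | A.RowStrict ∧ A.HasWeight lam}.Finite := by
  refine (Set.Finite.pi' (t := fun _ : μ.cells => Set.Iic (lam.colLen 0).succPNat)
    fun _ => Set.finite_Iic _).subset ?_
  rintro A ⟨-, hA⟩ x
  have h1 : 0 < lam.rowLen (A x).natPred := by
    rw [← hA, Finset.card_pos]
    exact ⟨x, by simp⟩
  rw [← YoungDiagram.mem_iff_lt_rowLen, YoungDiagram.mem_iff_lt_colLen] at h1
  rw [Set.mem_Iic, ← PNat.coe_le_coe, Nat.succPNat_coe, ← PNat.natPred_add_one]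
  omega

/-- The finite set of row-strict arrays of shape `μ` and weight `lam`. -/
noncomputable def rowStrictArrays (μ lam : YoungDiagram) : Finset (CellArray μ) :=
  (finite_rowStrictArrays μ lam).toFinset

end HallAlg

/-!
The coefficient of `u_μ` in `u_(1^r₁) ⋯ u_(1^r_s)` counts the flags in the module of type `μ`
whose successive quotients are elementary of ranks `r₁, …, r_s`. Both sides of the formula satisfy
the same recursion, which peels off the last factor, provided that `μ` is allowed to be any finite
family `α : ι → ℕ` of row lengths, unsorted and possibly with zeros; write `M_α = ⨁ R / 𝔪 ^ α_i`.

On the module side, the last step of a flag is a submodule `A` of `M_α` killed by `𝔪`. Let `p` be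
a uniformizer. The elements `p ^ (α_i - 1) e_i` with `α_i > 0` form a basis of the socle; ordered
by `RowLT α` (shorter rows first, and from the bottom up among rows of equal length), they give
`A` a reduced echelon form with a pivot set `I` of nonempty rows and coefficients `c_ij` for
`i ∈ I` and `j ∉ I` with `i` before `j` (`exists_eq_ker_cellMap`, `ker_cellMap_injective`). As
`α_i ≤ α_j` for these pairs, `x_j ↦ x_j - ∑ c_ij p ^ (α_j - α_i) x_i` is well defined, and with
the reductions `R / 𝔪 ^ α_i → R / 𝔪 ^ (α_i - 1)` for `i ∈ I` it defines a surjection with kernel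
`A` from `M_α` to `M_β`, where `β` is `α` with the entries in `I` lowered by one. So the
isomorphism type of `M_α / A` depends only on `I`, and there are `q ^ cellDim α I` submodules `A`
with pivot set `I` (`coeff_cyclicSum_mul_ones`). Unrolling the recursion gives a sum over the
sequences of sets of rows (`coeff_cyclicSum_prod_ones`).

On the side of arrays, a row-strict array is the same as the sequence of the sets `T_l` of the
rows that contain the label `l` (`sum_rowStrictArrays`). A pair of cells `(x, y)` counted by
Zelevinsky's statistic is determined by the label `l` of `y` and by the rows of `y` and `x`: both
cells are the ends of their rows once the labels up to `l` have been placed. The pairs belonging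
to `l` are therefore those counted by `cellDim` for the shape at that stage and the set `T_l`
(`zelevinsky_eq_flagDim`).

That the expansion in the `u_μ` exists and is unique is the classification of finite modules by
partitions (`existsUnique_eq_sum_uElt`). -/

namespace HallAlg
open IsLocalRing

/-! ### Reduced echelon forms -/

section Echelon

variable {K ι : Type*} [Field K] [Fintype ι]

/-- The subspace of vectors whose coordinates outside `I` are the linear functions of the
coordinates in `I` with coefficients `C (i, j)`. -/
def echelonSpace (I : Finset ι) (C : ι × ι → K) : Submodule K (ι → K) where
  carrier := {w | ∀ j ∉ I, w j = ∑ i, C (i, j) * w i}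
  add_mem' := fun {v w} hv hw j hj => by
    simp only [Pi.add_apply, hv j hj, hw j hj, mul_add, Finset.sum_add_distrib]
  zero_mem' := fun j _ => by simp
  smul_mem' := fun a w hw j hj => by
    simp only [Pi.smul_apply, smul_eq_mul, hw j hj, Finset.mul_sum, mul_left_comm]

/-- The coefficient matrices of the reduced echelon forms with pivot set `I` for the ordering `r` of
the coordinates: the entry at `(i, j)` vanishes unless `i` is a pivot, `j` is not, and `i`
precedes `j`. -/
def IsEchelon (r : ι → ι → Prop) (I : Finset ι) (C : ι × ι → K) : Prop :=
  ∀ i j, C (i, j) ≠ 0 → i ∈ I ∧ j ∉ I ∧ r i j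

variable {r : ι → ι → Prop}

open Classical in
theorem IsEchelon.row_mem {I : Finset ι} {C : ι × ι → K} (hC : IsEchelon r I C) {i : ι}
    (hi : i ∈ I) :
    (fun k => if k ∈ I then (if k = i then 1 else 0) else C (i, k)) ∈ echelonSpace I C := by
  intro j hj
  rw [Finset.sum_eq_single i]
  · simp [hj, hi]
  · intro i' _ hne
    by_cases h : C (i', j) = 0
    · simp [h]
    · simp [(hC _ _ h).1, hne]
  · simp

variable [IsStrictTotalOrder ι r]

/-- The pivots of a reduced echelon form are the leading positions of the vectors of its space. -/
theorem IsEchelon.mem_iff {I : Finset ι} {C : ι × ι → K} (hC : IsEchelon r I C) (i : ι) :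
    i ∈ I ↔ ∃ w ∈ echelonSpace I C, w i ≠ 0 ∧ ∀ j, r j i → w j = 0 := by
  classical
  constructor
  · intro hi
    refine ⟨_, hC.row_mem hi, by simp [hi], fun j hj => ?_⟩
    have hji : j ≠ i := fun h => irrefl_of r i (h ▸ hj)
    by_cases hjI : j ∈ I
    · simp [hjI, hji]
    · simp only [hjI, if_false]
      by_contra h
      exact asymm_of r hj (hC _ _ h).2.2
  · rintro ⟨w, hw, hwi, hlead⟩
    by_contra hi
    refine hwi ((hw i hi).trans (Finset.sum_eq_zero fun i' _ => ?_))
    by_cases h : C (i', i) = 0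
    · simp [h]
    · rw [hlead _ (hC _ _ h).2.2, mul_zero]

theorem IsEchelon.unique {I I' : Finset ι} {C C' : ι × ι → K} (hC : IsEchelon r I C)
    (hC' : IsEchelon r I' C') (h : echelonSpace I C = echelonSpace I' C') : I = I' ∧ C = C' := by
  classical
  have hI : I = I' := by
    ext i
    rw [hC.mem_iff, hC'.mem_iff, h]
  subst hI
  refine ⟨rfl, ?_⟩
  ext ⟨i, j⟩
  by_cases hij : i ∈ I ∧ j ∉ I
  · have h1 := hC.row_mem hij.1
    rw [h] at h1
    have h2 := h1 j hij.2
    rw [Finset.sum_eq_single i] at h2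
    · simpa [hij.1, hij.2] using h2
    · intro i' _ hne
      by_cases h : C' (i', j) = 0
      · simp [h]
      · simp [(hC' _ _ h).1, hne]
    · simp
  · have h1 : C (i, j) = 0 := by
      by_contra h
      exact hij ⟨(hC _ _ h).1, (hC _ _ h).2.1⟩
    have h2 : C' (i, j) = 0 := by
      by_contra h
      exact hij ⟨(hC' _ _ h).1, (hC' _ _ h).2.1⟩
    rw [h1, h2]

variable (r) in
/-- Every subspace has a reduced echelon form. -/
theorem exists_isEchelon (S : Submodule K (ι → K)) :
    ∃ (I : Finset ι) (C : ι × ι → K), IsEchelon r I C ∧ S = echelonSpace I C := by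
  classical
  let I : Finset ι := Finset.univ.filter fun i => ∃ w ∈ S, w i ≠ 0 ∧ ∀ j, r j i → w j = 0
  have hI : ∀ i, i ∈ I ↔ ∃ w ∈ S, w i ≠ 0 ∧ ∀ j, r j i → w j = 0 := fun i => by simp [I]
  have hwf : WellFounded (flip r) := by
    have : IsTrans ι (flip r) := ⟨fun a b c hab hbc => trans_of r hbc hab⟩
    have : Std.Irrefl (flip r) := ⟨fun a h => irrefl_of r a h⟩
    exact Finite.wellFounded_of_trans_of_irrefl _
  have hwf' : WellFounded r := Finite.wellFounded_of_trans_of_irrefl _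
  -- The rows of the reduced echelon form exist by induction from the last pivot to the first:
  -- subtract from a vector with leading position `i` its components along the rows of the later
  -- pivots.
  have hv : ∀ i, i ∈ I → ∃ v ∈ S, v i = 1 ∧ (∀ j ∈ I, j ≠ i → v j = 0) ∧ ∀ j, r j i → v j = 0 := by
    intro i
    induction i using hwf.induction with
    | _ i ih =>
      intro hi
      obtain ⟨w₀, hw₀, h0, hlead₀⟩ := (hI i).1 hi
      obtain ⟨w, hw, hw1, hlead⟩ : ∃ w ∈ S, w i = 1 ∧ ∀ j, r j i → w j = 0 :=
        ⟨(w₀ i)⁻¹ • w₀, S.smul_mem _ hw₀, by simp [h0], fun j hj => by simp [hlead₀ j hj]⟩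
      choose! v hvS hv1 hvI hvr using ih
      refine ⟨w - ∑ i' ∈ I.filter (fun i' => r i i'), w i' • v i', ?_, ?_, ?_, ?_⟩
      · refine S.sub_mem hw (S.sum_mem fun i' hi' => S.smul_mem _ ?_)
        rw [Finset.mem_filter] at hi'
        exact hvS i' hi'.2 hi'.1
      · rw [Pi.sub_apply, Finset.sum_apply, Finset.sum_eq_zero, hw1, sub_zero]
        intro i' hi'
        rw [Finset.mem_filter] at hi'
        simp [hvr i' hi'.2 hi'.1 i hi'.2]
      · intro j hj hji
        rw [Pi.sub_apply, Finset.sum_apply]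
        rcases trichotomous_of r i j with hij | hij | hij
        · rw [Finset.sum_eq_single j]
          · simp [hv1 j hij hj]
          · intro i' hi' hne
            rw [Finset.mem_filter] at hi'
            simp [hvI i' hi'.2 hi'.1 j hj hne.symm]
          · intro h
            exact absurd (Finset.mem_filter.2 ⟨hj, hij⟩) h
        · exact absurd hij.symm hji
        · rw [Finset.sum_eq_zero, hlead j hij, sub_zero]
          intro i' hi'
          rw [Finset.mem_filter] at hi'
          simp [hvr i' hi'.2 hi'.1 j (trans_of r hij hi'.2)]
      · intro j hij
        rw [Pi.sub_apply, Finset.sum_apply, Finset.sum_eq_zero, hlead j hij, sub_zero]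
        intro i' hi'
        rw [Finset.mem_filter] at hi'
        simp [hvr i' hi'.2 hi'.1 j (trans_of r hij hi'.2)]
  choose! v hvS hv1 hvI hvr using hv
  let C : ι × ι → K := fun p => if p.1 ∈ I ∧ p.2 ∉ I then v p.1 p.2 else 0
  have hC : ∀ j ∉ I, ∀ w : ι → K, ∑ i, C (i, j) * w i = ∑ i ∈ I, w i * v i j := by
    intro j hj w
    rw [← Finset.sum_filter_add_sum_filter_not Finset.univ (· ∈ I), Finset.filter_mem_eq_inter,
      Finset.univ_inter, Finset.sum_eq_zero (s := Finset.univ.filter (· ∉ I)), add_zero]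
    · exact Finset.sum_congr rfl fun i hi => by simp [C, hi, hj, mul_comm]
    · intro i hi
      simp [C, (Finset.mem_filter.1 hi).2]
  have hcoord : ∀ w : ι → K, ∀ k ∈ I, ∑ i ∈ I, w i * v i k = w k := by
    intro w k hk
    rw [Finset.sum_eq_single k (fun i hi hne => by rw [hvI i hi k hk hne.symm, mul_zero])
      (fun h => absurd hk h), hv1 k hk, mul_one]
  refine ⟨I, C, ?_, ?_⟩
  · intro i j hij
    have h : i ∈ I ∧ j ∉ I := by
      by_contra h
      simp [C, h] at hij
    refine ⟨h.1, h.2, ?_⟩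
    simp only [C, h, not_false_eq_true, and_self, if_true] at hij
    rcases trichotomous_of r i j with h1 | h1 | h1
    · exact h1
    · exact absurd (h1 ▸ h.1) h.2
    · exact absurd (hvr i h.1 j h1) hij
  · ext w
    constructor
    · intro hw
      have hu : w - ∑ i ∈ I, w i • v i ∈ S :=
        S.sub_mem hw (S.sum_mem fun i hi => S.smul_mem _ (hvS i hi))
      -- The first nonzero coordinate of this difference would be a pivot, but the difference
      -- vanishes at the pivots.
      have hz : ∀ k, (w - ∑ i ∈ I, w i • v i) k = 0 := by
        intro k
        induction k using hwf'.induction with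
        | _ k ih =>
          by_contra hk
          have hkI : k ∈ I := (hI k).2 ⟨_, hu, hk, ih⟩
          refine hk ?_
          simp only [Pi.sub_apply, Finset.sum_apply, Pi.smul_apply, smul_eq_mul]
          rw [hcoord w k hkI, sub_self]
      intro j hj
      rw [hC j hj, ← sub_eq_zero, ← hz j]
      simp
    · intro hw
      have h : w = ∑ i ∈ I, w i • v i := by
        ext k
        simp only [Finset.sum_apply, Pi.smul_apply, smul_eq_mul]
        by_cases hk : k ∈ I
        · exact (hcoord w k hk).symm
        · rw [hw k hk, hC k hk]
      rw [h]
      exact S.sum_mem fun i hi => S.smul_mem _ (hvS i hi)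

open Classical in
theorem card_isEchelon [Finite K] (r : ι → ι → Prop) (I : Finset ι) :
    Nat.card {C : ι × ι → K // IsEchelon r I C} =
      Nat.card K ^ (Finset.univ.filter fun p : ι × ι => p.1 ∈ I ∧ p.2 ∉ I ∧ r p.1 p.2).card := by
  have := Fintype.ofFinite K
  let F : Finset (ι × ι → K) := Fintype.piFinset fun p =>
    if p.1 ∈ I ∧ p.2 ∉ I ∧ r p.1 p.2 then Finset.univ else {0}
  have hF : ∀ C, C ∈ F ↔ IsEchelon r I C := by
    intro C
    simp only [F, Fintype.mem_piFinset, IsEchelon, Prod.forall]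
    refine forall₂_congr fun i j => ?_
    split_ifs with h
    · simp [h]
    · simp only [Finset.mem_singleton]
      tauto
  rw [← Nat.card_congr (Equiv.subtypeEquivRight hF), Nat.card_eq_fintype_card, Fintype.card_coe,
    Fintype.card_piFinset, Nat.card_eq_fintype_card, ← Finset.prod_const, Finset.prod_filter]
  refine Finset.prod_congr rfl fun p _ => ?_
  split_ifs <;> simp

end Echelon

/-! ### Elementary submodules of a direct sum of cyclic modules -/

section Maps

variable {R : Type u} [CommRing R] [IsDomain R] [IsDiscreteValuationRing R]

variable (R) in
theorem subsingleton_quotient_pow {n : ℕ} (hn : n = 0) :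
    Subsingleton (R ⧸ maximalIdeal R ^ n) := by
  rw [hn, pow_zero]
  exact Ideal.Quotient.subsingleton_iff.2 Ideal.one_eq_top

theorem mem_maximalIdeal_pow {p : R} (hp : Irreducible p) {n : ℕ} {x : R} :
    x ∈ maximalIdeal R ^ n ↔ p ^ n ∣ x := by
  rw [hp.maximalIdeal_eq, Ideal.span_singleton_pow, Ideal.mem_span_singleton]

/-- Multiplication by `c p ^ (b - a)`, as a map from `R / 𝔪 ^ a` to `R / 𝔪 ^ b`. With the
truncated difference `b - a`, it is well defined for all `a` and `b`. -/
noncomputable def shiftMap {p : R} (hp : Irreducible p) (a b : ℕ) (c : R) :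
    (R ⧸ maximalIdeal R ^ a) →ₗ[R] (R ⧸ maximalIdeal R ^ b) :=
  Submodule.mapQ _ _ (LinearMap.mulLeft R (c * p ^ (b - a))) fun x hx => by
    rw [Submodule.mem_comap, LinearMap.mulLeft_apply, mem_maximalIdeal_pow hp]
    rw [mem_maximalIdeal_pow hp] at hx
    have h : p ^ b ∣ p ^ (b - a) * p ^ a := by
      rw [← pow_add]
      exact pow_dvd_pow _ (by omega)
    exact h.trans (mul_dvd_mul (Dvd.intro_left c rfl) hx)

theorem shiftMap_mk {p : R} (hp : Irreducible p) (a b : ℕ) (c x : R) :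
    shiftMap hp a b c (Ideal.Quotient.mk _ x) = Ideal.Quotient.mk _ (c * p ^ (b - a) * x) := rfl

theorem shiftMap_zero {p : R} (hp : Irreducible p) (a b : ℕ) : shiftMap hp a b 0 = 0 := by
  ext
  rw [LinearMap.comp_apply, Submodule.mkQ_apply]
  exact (shiftMap_mk hp a b 0 1).trans (by simp)

/-- The map from the residue field to `R / 𝔪 ^ a` that sends `1` to `p ^ (a - 1)`: it
parametrizes the elements killed by `p`, injectively unless `a = 0`. -/
noncomputable def socleMap {p : R} (hp : Irreducible p) (a : ℕ) :
    ResidueField R →ₗ[R] (R ⧸ maximalIdeal R ^ a) :=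
  Submodule.mapQ (maximalIdeal R) _ (LinearMap.mulLeft R (p ^ (a - 1))) fun x hx => by
    rw [Submodule.mem_comap, LinearMap.mulLeft_apply, mem_maximalIdeal_pow hp]
    rw [← pow_one (maximalIdeal R), mem_maximalIdeal_pow hp] at hx
    have h : p ^ a ∣ p ^ (a - 1) * p ^ 1 := by
      rw [← pow_add]
      exact pow_dvd_pow _ (by omega)
    exact h.trans (mul_dvd_mul dvd_rfl hx)

theorem socleMap_residue {p : R} (hp : Irreducible p) (a : ℕ) (x : R) :
    socleMap hp a (residue R x) = Ideal.Quotient.mk _ (p ^ (a - 1) * x) := rfl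

theorem socleMap_injective {p : R} (hp : Irreducible p) {a : ℕ} (ha : 0 < a) :
    Function.Injective (socleMap hp a) := by
  rw [injective_iff_map_eq_zero]
  intro t ht
  obtain ⟨x, rfl⟩ := residue_surjective t
  rw [socleMap_residue, Ideal.Quotient.eq_zero_iff_mem, mem_maximalIdeal_pow hp] at ht
  obtain ⟨b, rfl⟩ := Nat.exists_eq_succ_of_ne_zero ha.ne'
  rw [Nat.succ_eq_add_one, Nat.add_sub_cancel, pow_succ,
    mul_dvd_mul_iff_left (pow_ne_zero _ hp.ne_zero)] at ht
  rw [residue_eq_zero_iff, ← pow_one (maximalIdeal R), mem_maximalIdeal_pow hp, pow_one]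
  exact ht

theorem exists_socleMap_of_mem {p : R} (hp : Irreducible p) {a : ℕ} {z : R}
    (hz : p ^ (a - 1) ∣ z) :
    ∃ t, socleMap hp a t = Ideal.Quotient.mk (maximalIdeal R ^ a) z := by
  obtain ⟨x, rfl⟩ := hz
  exact ⟨residue R x, socleMap_residue hp a x⟩

theorem exists_socleMap_of_smul_eq_zero {p : R} (hp : Irreducible p) {a : ℕ}
    {y : R ⧸ maximalIdeal R ^ a} (hy : p • y = 0) : ∃ t, socleMap hp a t = y := by
  obtain ⟨z, rfl⟩ := Ideal.Quotient.mk_surjective y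
  refine exists_socleMap_of_mem hp ?_
  have h : Ideal.Quotient.mk (maximalIdeal R ^ a) (p * z) = 0 := hy
  rw [Ideal.Quotient.eq_zero_iff_mem, mem_maximalIdeal_pow hp] at h
  rcases Nat.eq_zero_or_pos a with rfl | ha
  · simp
  · obtain ⟨b, rfl⟩ := Nat.exists_eq_succ_of_ne_zero ha.ne'
    rwa [Nat.succ_eq_add_one, pow_succ', mul_dvd_mul_iff_left hp.ne_zero] at h

theorem smul_socleMap {p : R} (hp : Irreducible p) (a : ℕ) (t : ResidueField R) :
    p • socleMap hp a t = 0 := by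
  obtain ⟨x, rfl⟩ := residue_surjective t
  rw [← map_smul]
  have h : p • residue R x = residue R (p * x) := rfl
  rw [h, map_mul, (residue_eq_zero_iff p).2 ((mem_maximalIdeal p).2 hp.not_isUnit), zero_mul,
    map_zero]

theorem shiftMap_socleMap {p : R} (hp : Irreducible p) {a b : ℕ} (ha : 0 < a) (hab : a ≤ b)
    (c : R) (t : ResidueField R) :
    shiftMap hp a b c (socleMap hp a t) = socleMap hp b (residue R c * t) := by
  obtain ⟨x, rfl⟩ := residue_surjective t
  rw [socleMap_residue, shiftMap_mk, ← map_mul, socleMap_residue]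
  have h : p ^ (b - 1) = p ^ (b - a) * p ^ (a - 1) := by
    rw [← pow_add]
    congr 1
    omega
  rw [h]
  congr 1
  ring

/-- The projection from `R / 𝔪 ^ a` to `R / 𝔪 ^ b` for `b ≤ a`. -/
noncomputable def redMap (R : Type u) [CommRing R] [IsDomain R] [IsDiscreteValuationRing R]
    {a b : ℕ} (h : b ≤ a) :
    (R ⧸ maximalIdeal R ^ a) →ₗ[R] (R ⧸ maximalIdeal R ^ b) :=
  Submodule.mapQ _ _ LinearMap.id fun _ hx => Ideal.pow_le_pow_right h hx

theorem redMap_mk {a b : ℕ} (h : b ≤ a) (x : R) :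
    redMap R h (Ideal.Quotient.mk _ x) = Ideal.Quotient.mk _ x := rfl

theorem redMap_surjective {a b : ℕ} (h : b ≤ a) : Function.Surjective (redMap R h) := by
  intro y
  obtain ⟨z, rfl⟩ := Ideal.Quotient.mk_surjective y
  exact ⟨_, redMap_mk h z⟩

theorem redMap_eq_zero_of_eq {a b : ℕ} (h : b ≤ a) (hab : b = a) {y : R ⧸ maximalIdeal R ^ a}
    (hy : redMap R h y = 0) : y = 0 := by
  subst hab
  obtain ⟨z, rfl⟩ := Ideal.Quotient.mk_surjective y
  exact hy

theorem exists_socleMap_of_redMap_eq_zero {p : R} (hp : Irreducible p) {a b : ℕ} (h : b ≤ a)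
    (hab : b = a - 1) {y : R ⧸ maximalIdeal R ^ a} (hy : redMap R h y = 0) :
    ∃ t, socleMap hp a t = y := by
  subst hab
  obtain ⟨z, rfl⟩ := Ideal.Quotient.mk_surjective y
  rw [redMap_mk, Ideal.Quotient.eq_zero_iff_mem, mem_maximalIdeal_pow hp] at hy
  exact exists_socleMap_of_mem hp hy

theorem redMap_socleMap {p : R} (hp : Irreducible p) {a b : ℕ} (h : b ≤ a)
    (hab : b = a - 1) (t : ResidueField R) : redMap R h (socleMap hp a t) = 0 := by
  subst hab
  obtain ⟨x, rfl⟩ := residue_surjective t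
  rw [socleMap_residue, redMap_mk, Ideal.Quotient.eq_zero_iff_mem, mem_maximalIdeal_pow hp]
  exact Dvd.intro _ rfl

variable (R) in
theorem exists_residue_section :
    ∃ f : ResidueField R → R, (∀ t, residue R (f t) = t) ∧ f 0 = 0 := by
  classical
  obtain ⟨g, hg⟩ := (residue_surjective (R := R)).hasRightInverse
  refine ⟨fun t => if t = 0 then 0 else g t, fun t => ?_, by simp⟩
  by_cases h : t = 0
  · simp [h]
  · simp only [h, if_false]
    exact hg t

/-- A lift of the elements of the residue field to `R`, with `0` lifted to `0`, so that a vanishing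
coefficient gives the zero map between cyclic summands of any lengths. -/
noncomputable def liftRes (t : ResidueField R) : R := (exists_residue_section R).choose t

theorem residue_liftRes (t : ResidueField R) : residue R (liftRes t) = t :=
  (exists_residue_section R).choose_spec.1 t

theorem liftRes_zero : liftRes (0 : ResidueField R) = 0 :=
  (exists_residue_section R).choose_spec.2

end Maps

/-- The direct sum of the modules `R / 𝔪 ^ α_i`, for a finite family `α` in any order and with
zeros allowed. -/
abbrev CyclicSum (R : Type u) [CommRing R] [IsLocalRing R] {ι : Type} (α : ι → ℕ) : Type u :=
  (i : ι) → R ⧸ maximalIdeal R ^ α i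

section Shapes

variable {ι : Type}

open Classical in
/-- The family `α` with the entries in `I` lowered by one. -/
noncomputable def lower (α : ι → ℕ) (I : Finset ι) (i : ι) : ℕ := if i ∈ I then α i - 1 else α i

theorem lower_le (α : ι → ℕ) (I : Finset ι) (i : ι) : lower α I i ≤ α i := by
  unfold lower
  split_ifs <;> omega

theorem lower_of_mem {α : ι → ℕ} {I : Finset ι} {i : ι} (h : i ∈ I) : lower α I i = α i - 1 :=
  if_pos h

theorem lower_of_notMem {α : ι → ℕ} {I : Finset ι} {i : ι} (h : i ∉ I) : lower α I i = α i :=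
  if_neg h

/-- Zelevinsky's order on the ends of the rows of lengths `α`: row `i` precedes row `j` if it is
shorter, or of the same length and below row `j`. -/
def RowLT [LinearOrder ι] (α : ι → ℕ) (i j : ι) : Prop := α i < α j ∨ α i = α j ∧ j < i

instance [LinearOrder ι] (α : ι → ℕ) : IsStrictTotalOrder ι (RowLT α) where
  irrefl i h := by
    rcases h with h | h
    · exact lt_irrefl _ h
    · exact lt_irrefl _ h.2
  trans i j k h h' := by
    unfold RowLT at *
    rcases h with h | h <;> rcases h' with h' | h'
    · exact Or.inl (h.trans h')
    · exact Or.inl (h'.1 ▸ h)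
    · exact Or.inl (h.1 ▸ h')
    · exact Or.inr ⟨h.1.trans h'.1, h'.2.trans h.2⟩
  trichotomous i j h h' := by
    unfold RowLT at *
    push Not at h h'
    have h1 : α i = α j := le_antisymm h'.1 h.1
    exact le_antisymm (h.2 h1) (h'.2 h1.symm)

theorem RowLT.le [LinearOrder ι] {α : ι → ℕ} {i j : ι} (h : RowLT α i j) : α i ≤ α j := by
  rcases h with h | h
  · exact h.le
  · exact h.1.le

end Shapes

section Socle

variable {R : Type u} [CommRing R] [IsDomain R] [IsDiscreteValuationRing R]
  {p : R} (hp : Irreducible p) {ι : Type} (α : ι → ℕ)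

/-- The map from vectors over the residue field to the elements of `⨁ R / 𝔪 ^ α_i` killed by `p`. -/
noncomputable def socleVec : (ι → ResidueField R) →ₗ[R] CyclicSum R α :=
  LinearMap.pi fun i => socleMap hp (α i) ∘ₗ LinearMap.proj i

theorem socleVec_apply (w : ι → ResidueField R) (i : ι) :
    socleVec hp α w i = socleMap hp (α i) (w i) := rfl

variable {α} in
theorem eq_of_socleVec_eq {w w' : ι → ResidueField R} (hw : ∀ i, α i = 0 → w i = 0)
    (hw' : ∀ i, α i = 0 → w' i = 0) (h : socleVec hp α w = socleVec hp α w') : w = w' := by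
  ext i
  rcases Nat.eq_zero_or_pos (α i) with h0 | h0
  · rw [hw i h0, hw' i h0]
  · exact socleMap_injective hp h0 (congrFun h i)

variable {α} in
theorem exists_socleVec_of_smul_eq_zero {x : CyclicSum R α} (hx : p • x = 0) :
    ∃ w, (∀ i, α i = 0 → w i = 0) ∧ socleVec hp α w = x := by
  classical
  have h : ∀ i, ∃ t, socleMap hp (α i) t = x i :=
    fun i => exists_socleMap_of_smul_eq_zero hp (congrFun hx i)
  choose t ht using h
  refine ⟨fun i => if α i = 0 then 0 else t i, fun i hi => if_pos hi, ?_⟩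
  ext i
  rw [socleVec_apply]
  split_ifs with h0
  · have := subsingleton_quotient_pow R h0
    exact Subsingleton.elim _ _
  · exact ht i

theorem shiftMap_eq_zero_of_notMem [LinearOrder ι] {α : ι → ℕ} {I : Finset ι}
    {C : ι × ι → ResidueField R} (hC : IsEchelon (RowLT α) I C) {i j : ι} (h : i ∉ I ∨ j ∈ I) :
    shiftMap hp (α i) (α j) (liftRes (C (i, j))) = 0 := by
  have h0 : C (i, j) = 0 := by
    by_contra h0
    have := hC _ _ h0
    tauto
  rw [h0, liftRes_zero, shiftMap_zero]

variable [Fintype ι]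

/-- The map from `⨁ R / 𝔪 ^ α_i` onto the direct sum for the lowered family whose kernel
corresponds to the echelon form `(I, C)`. -/
noncomputable def cellMap (I : Finset ι) (C : ι × ι → ResidueField R) :
    CyclicSum R α →ₗ[R] CyclicSum R (lower α I) :=
  LinearMap.pi fun j => redMap R (lower_le α I j) ∘ₗ
    (LinearMap.proj j - ∑ i, shiftMap hp (α i) (α j) (liftRes (C (i, j))) ∘ₗ LinearMap.proj i)

theorem cellMap_apply (I : Finset ι) (C : ι × ι → ResidueField R) (x : CyclicSum R α) (j : ι) :
    cellMap hp α I C x j = redMap R (lower_le α I j)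
      (x j - ∑ i, shiftMap hp (α i) (α j) (liftRes (C (i, j))) (x i)) := by
  simp [cellMap]

variable {α} {I : Finset ι} {C : ι × ι → ResidueField R} [LinearOrder ι]

theorem sum_shiftMap_socleMap (hC : IsEchelon (RowLT α) I C) (hI : ∀ i ∈ I, 0 < α i) (j : ι)
    (w : ι → ResidueField R) :
    ∑ i, shiftMap hp (α i) (α j) (liftRes (C (i, j))) (socleMap hp (α i) (w i)) =
      socleMap hp (α j) (∑ i, C (i, j) * w i) := by
  rw [map_sum]
  refine Finset.sum_congr rfl fun i _ => ?_
  by_cases h0 : C (i, j) = 0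
  · simp [h0, liftRes_zero, shiftMap_zero]
  · have h := hC _ _ h0
    rw [shiftMap_socleMap hp (hI i h.1) h.2.2.le, residue_liftRes]

theorem cellMap_surjective (hC : IsEchelon (RowLT α) I C) :
    Function.Surjective (cellMap hp α I C) := by
  intro y
  choose x hx using fun j => redMap_surjective (lower_le α I j) (y j)
  -- The correction is nonzero only for `j ∉ I` and involves only the coordinates `x i` with
  -- `i ∈ I`, which are themselves not corrected.
  refine ⟨fun j => x j + ∑ i, shiftMap hp (α i) (α j) (liftRes (C (i, j))) (x i), ?_⟩
  ext j
  rw [cellMap_apply, ← hx j]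
  congr 1
  rw [add_sub_assoc, ← Finset.sum_sub_distrib, Finset.sum_eq_zero, add_zero]
  intro i _
  by_cases hi : i ∈ I
  · have h : ∑ i', shiftMap hp (α i') (α i) (liftRes (C (i', i))) (x i') = 0 :=
      Finset.sum_eq_zero fun i' _ => by
        rw [shiftMap_eq_zero_of_notMem hp hC (Or.inr hi), LinearMap.zero_apply]
    rw [h, add_zero, sub_self]
  · rw [shiftMap_eq_zero_of_notMem hp hC (Or.inl hi), LinearMap.zero_apply, LinearMap.zero_apply,
      sub_zero]

theorem mem_ker_cellMap (hC : IsEchelon (RowLT α) I C) (hI : ∀ i ∈ I, 0 < α i)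
    {x : CyclicSum R α} :
    x ∈ LinearMap.ker (cellMap hp α I C) ↔ ∃ w ∈ echelonSpace I C, socleVec hp α w = x := by
  classical
  rw [LinearMap.mem_ker]
  constructor
  · intro hx
    have h1 : ∀ i ∈ I, ∃ t, socleMap hp (α i) t = x i := by
      intro i hi
      have h := congrFun hx i
      rw [cellMap_apply, Finset.sum_eq_zero, sub_zero] at h
      · exact exists_socleMap_of_redMap_eq_zero hp _ (lower_of_mem hi) h
      · intro i' _
        rw [shiftMap_eq_zero_of_notMem hp hC (Or.inr hi), LinearMap.zero_apply]
    choose! t ht using h1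
    let w : ι → ResidueField R := fun j => if j ∈ I then t j else ∑ i, C (i, j) * t i
    have hsum : ∀ j, ∑ i, C (i, j) * w i = ∑ i, C (i, j) * t i := by
      intro j
      refine Finset.sum_congr rfl fun i _ => ?_
      by_cases h0 : C (i, j) = 0
      · simp [h0]
      · simp [w, (hC _ _ h0).1]
    refine ⟨w, fun j hj => ?_, ?_⟩
    · rw [hsum]
      simp [w, hj]
    · ext j
      rw [socleVec_apply]
      by_cases hj : j ∈ I
      · simp [w, hj, ht j hj]
      · have h := congrFun hx j
        rw [cellMap_apply] at h
        have h2 := sub_eq_zero.1 (redMap_eq_zero_of_eq _ (lower_of_notMem hj) h)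
        rw [h2]
        simp only [w, hj, if_false]
        rw [← sum_shiftMap_socleMap hp hC hI]
        refine Finset.sum_congr rfl fun i _ => ?_
        by_cases hi : i ∈ I
        · rw [ht i hi]
        · rw [shiftMap_eq_zero_of_notMem hp hC (Or.inl hi), LinearMap.zero_apply,
            LinearMap.zero_apply]
  · rintro ⟨w, hw, rfl⟩
    ext j
    rw [cellMap_apply]
    simp only [socleVec_apply]
    rw [sum_shiftMap_socleMap hp hC hI]
    by_cases hj : j ∈ I
    · have h0 : ∑ i, C (i, j) * w i = 0 := Finset.sum_eq_zero fun i _ => by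
        by_cases h0 : C (i, j) = 0
        · simp [h0]
        · exact absurd hj (hC _ _ h0).2.1
      rw [h0, map_zero, sub_zero, redMap_socleMap hp _ (lower_of_mem hj)]
      rfl
    · rw [← hw j hj, sub_self, map_zero]
      rfl

/-- For an echelon form adapted to `α`, the vectors of its space vanish where `α` does. -/
theorem IsEchelon.eq_zero (hC : IsEchelon (RowLT α) I C) (hI : ∀ i ∈ I, 0 < α i)
    {w : ι → ResidueField R} (hw : w ∈ echelonSpace I C) (j : ι) (hj : α j = 0) : w j = 0 := by
  have hjI : j ∉ I := fun h => (hI j h).ne' hj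
  refine (hw j hjI).trans (Finset.sum_eq_zero fun i _ => ?_)
  by_cases h0 : C (i, j) = 0
  · simp [h0]
  · have h := hC _ _ h0
    have := hI i h.1
    have := h.2.2.le
    omega

theorem ker_cellMap_injective (hC : IsEchelon (RowLT α) I C) (hI : ∀ i ∈ I, 0 < α i)
    {I' : Finset ι} {C' : ι × ι → ResidueField R} (hC' : IsEchelon (RowLT α) I' C')
    (hI' : ∀ i ∈ I', 0 < α i)
    (h : LinearMap.ker (cellMap hp α I C) = LinearMap.ker (cellMap hp α I' C')) :
    I = I' ∧ C = C' := by
  refine hC.unique hC' (le_antisymm ?_ ?_)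
  · intro w hw
    have h1 := (mem_ker_cellMap hp hC hI).2 ⟨w, hw, rfl⟩
    rw [h, mem_ker_cellMap hp hC' hI'] at h1
    obtain ⟨w', hw', h2⟩ := h1
    rwa [← eq_of_socleVec_eq hp (hC'.eq_zero hI' hw') (hC.eq_zero hI hw) h2]
  · intro w hw
    have h1 := (mem_ker_cellMap hp hC' hI').2 ⟨w, hw, rfl⟩
    rw [← h, mem_ker_cellMap hp hC hI] at h1
    obtain ⟨w', hw', h2⟩ := h1
    rwa [← eq_of_socleVec_eq hp (hC.eq_zero hI hw') (hC'.eq_zero hI' hw) h2]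

/-- Every submodule killed by `p` comes from an echelon form. -/
theorem exists_eq_ker_cellMap (A : Submodule R (CyclicSum R α)) (hA : ∀ x ∈ A, p • x = 0) :
    ∃ (I : Finset ι) (C : ι × ι → ResidueField R), IsEchelon (RowLT α) I C ∧ (∀ i ∈ I, 0 < α i) ∧
      A = LinearMap.ker (cellMap hp α I C) := by
  classical
  -- The condition at the zeros of `α`, where `socleVec` loses information, forces the pivots to
  -- be rows of positive length.
  let U : Submodule (ResidueField R) (ι → ResidueField R) :=
    { carrier := {w | (∀ i, α i = 0 → w i = 0) ∧ socleVec hp α w ∈ A}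
      add_mem' := fun {v w} hv hw => ⟨fun i hi => by simp [hv.1 i hi, hw.1 i hi], by
        rw [map_add]
        exact A.add_mem hv.2 hw.2⟩
      zero_mem' := ⟨fun i _ => rfl, by
        rw [map_zero]
        exact A.zero_mem⟩
      smul_mem' := fun c w hw => ⟨fun i hi => by simp [hw.1 i hi], by
        obtain ⟨x, rfl⟩ := residue_surjective c
        have h : residue R x • w = x • w := rfl
        rw [h, map_smul]
        exact A.smul_mem _ hw.2⟩ }
  obtain ⟨I, C, hC, hU⟩ := exists_isEchelon (RowLT α) U
  have hI : ∀ i ∈ I, 0 < α i := by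
    intro i hi
    have h := hC.row_mem hi
    rw [← hU] at h
    by_contra h0
    have := h.1 i (by omega)
    simp [hi] at this
  refine ⟨I, C, hC, hI, ?_⟩
  ext x
  rw [mem_ker_cellMap hp hC hI, ← hU]
  constructor
  · intro hx
    obtain ⟨w, hw0, rfl⟩ := exists_socleVec_of_smul_eq_zero hp (hA x hx)
    exact ⟨w, ⟨hw0, hx⟩, rfl⟩
  · rintro ⟨w, hw, rfl⟩
    exact hw.2

/-- The submodule of an echelon form with pivot set `I` is a vector space of dimension `#I`. -/
theorem nonempty_ker_cellMap_equiv (hC : IsEchelon (RowLT α) I C) (hI : ∀ i ∈ I, 0 < α i) :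
    Nonempty (LinearMap.ker (cellMap hp α I C) ≃ₗ[R] (Fin I.card → ResidueField R)) := by
  classical
  let e₁ : echelonSpace I C →ₗ[R] (I → ResidueField R) :=
    { toFun := fun w i => w.1 i
      map_add' := fun _ _ => rfl
      map_smul' := fun _ _ => rfl }
  have he₁ : Function.Bijective e₁ := by
    constructor
    · rintro ⟨w, hw⟩ ⟨w', hw'⟩ h
      have h1 : ∀ i ∈ I, w i = w' i := fun i hi => congrFun h ⟨i, hi⟩
      refine Subtype.ext (funext fun j => ?_)
      by_cases hj : j ∈ I
      · exact h1 j hj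
      · refine (hw j hj).trans (Eq.trans ?_ (hw' j hj).symm)
        refine Finset.sum_congr rfl fun i _ => ?_
        by_cases h0 : C (i, j) = 0
        · simp [h0]
        · rw [h1 i (hC _ _ h0).1]
    · intro t
      let t' : ι → ResidueField R := fun i => if h : i ∈ I then t ⟨i, h⟩ else 0
      refine ⟨⟨fun j => if j ∈ I then t' j else ∑ i, C (i, j) * t' i, fun j hj => ?_⟩, ?_⟩
      · simp only [hj, if_false]
        refine Finset.sum_congr rfl fun i _ => ?_
        by_cases h0 : C (i, j) = 0
        · simp [h0]
        · simp [(hC _ _ h0).1]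
      · ext ⟨i, hi⟩
        simp [e₁, t', hi]
  let e₂ : echelonSpace I C →ₗ[R] LinearMap.ker (cellMap hp α I C) :=
    { toFun := fun w => ⟨socleVec hp α w.1, (mem_ker_cellMap hp hC hI).2 ⟨w.1, w.2, rfl⟩⟩
      map_add' := fun v w => Subtype.ext (map_add (socleVec hp α) v.1 w.1)
      map_smul' := fun r w => Subtype.ext (map_smul (socleVec hp α) r w.1) }
  have he₂ : Function.Bijective e₂ := by
    constructor
    · rintro ⟨w, hw⟩ ⟨w', hw'⟩ h
      exact Subtype.ext (eq_of_socleVec_eq hp (hC.eq_zero hI hw) (hC.eq_zero hI hw')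
        (congrArg Subtype.val h))
    · rintro ⟨x, hx⟩
      obtain ⟨w, hw, rfl⟩ := (mem_ker_cellMap hp hC hI).1 hx
      exact ⟨⟨w, hw⟩, rfl⟩
  exact ⟨(LinearEquiv.ofBijective e₂ he₂).symm.trans ((LinearEquiv.ofBijective e₁ he₁).trans
    (LinearEquiv.funCongrLeft R _ I.equivFin.symm))⟩

end Socle

/-! ### Multiplication by the class of an elementary module -/

section Recursion

variable {R : Type u} [CommRing R] [IsDomain R] [IsDiscreteValuationRing R]

theorem rowLen_ones {r : ℕ} (i : Fin ((ones r).colLen 0)) : (ones r).rowLen i = 1 := by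
  have h1 : (ones r).rowLens = List.replicate r 1 :=
    YoungDiagram.rowLens_ofRowLens_eq_self fun x hx => by simp [List.eq_of_mem_replicate hx]
  have h2 : (ones r).rowLen i ∈ (ones r).rowLens :=
    List.mem_map.2 ⟨i, List.mem_range.2 i.2, rfl⟩
  rw [h1] at h2
  exact List.eq_of_mem_replicate h2

theorem colLen_ones (r : ℕ) : (ones r).colLen 0 = r := by
  rw [← YoungDiagram.length_rowLens, ones, YoungDiagram.rowLens_ofRowLens_eq_self,
    List.length_replicate]
  intro x hx
  simp [List.eq_of_mem_replicate hx]

variable (R) in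
theorem nonempty_typeModule_ones_equiv (r : ℕ) :
    Nonempty (TypeModule R (ones r) ≃ₗ[R] (Fin r → ResidueField R)) := by
  have e₁ : ∀ i : Fin ((ones r).colLen 0),
      (R ⧸ maximalIdeal R ^ (ones r).rowLen i) ≃ₗ[R] ResidueField R := fun i =>
    Submodule.quotEquivOfEq (maximalIdeal R ^ (ones r).rowLen i) (maximalIdeal R)
      (by rw [rowLen_ones, pow_one])
  exact ⟨(LinearEquiv.piCongrRight e₁).trans
    (LinearEquiv.funCongrLeft R _ (finCongr (colLen_ones r).symm))⟩

variable [Finite (ResidueField R)]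

noncomputable local instance fintypeSubmoduleClass {M : Type u} [AddCommGroup M] [Module R M]
    [Finite M] (L : IsoClass R) : Fintype {A : Submodule R M // cls R A = L} :=
  Fintype.ofFinite _

open Classical in
/-- The coefficient of a product whose right factor is the basis element `L`, as a sum over the
submodules in the class `L`. -/
theorem coeff_mul_basisElt (a : Hall R) (L : IsoClass R) (M : Type u) [AddCommGroup M] [Module R M]
    [Finite M] :
    coeff R (cls R M) (a * basisElt R L) =
      ∑ A : {A : Submodule R M // cls R A = L}, coeff R (cls R (M ⧸ A.1)) a := by
  -- Both sides are additive in `a`, so that `a` may be taken to be a basis element.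
  let f : Hall R →+ ℤ := (coeff R (cls R M)).comp ((hallMul R).flip (basisElt R L))
  let g : Hall R →+ ℤ := ∑ A : {A : Submodule R M // cls R A = L}, coeff R (cls R (M ⧸ A.1))
  have h : f = g := by
    refine hall_hom_ext R fun N => ?_
    have h1 : f (basisElt R N) = coeff R (cls R M) (basisElt R N * basisElt R L) := rfl
    rw [h1, coeff_mul, hallNumber_cls, hallCount, AddMonoidHom.finsetSum_apply]
    simp only [coeff_basisElt]
    rw [← Finset.natCast_card_filter, Nat.cast_inj, ← Fintype.card_subtype,
      ← Nat.card_eq_fintype_card]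
    exact Nat.card_congr
      { toFun := fun A => ⟨⟨A.1, A.2.2⟩, A.2.1.symm⟩
        invFun := fun A => ⟨A.1.1, A.2.symm, A.1.2⟩
        left_inv := fun _ => rfl
        right_inv := fun _ => rfl }
  have h2 := DFunLike.congr_fun h a
  rw [AddMonoidHom.finsetSum_apply] at h2
  exact h2

/-- The number of pairs of rows `i ∈ I`, `j ∉ I` for which the end of row `i` precedes the end of
row `j`. -/
noncomputable def cellDim {ι : Type} [Fintype ι] [LinearOrder ι] (α : ι → ℕ) (I : Finset ι) : ℕ :=
  open Classical in
  (Finset.univ.filter fun p : ι × ι => p.1 ∈ I ∧ p.2 ∉ I ∧ RowLT α p.1 p.2).card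

open Classical in
/-- The recursion on the side of modules: the elementary submodules of rank `r` are grouped by their
pivot sets `I`. -/
theorem coeff_cyclicSum_mul_ones {ι : Type} [Fintype ι] [LinearOrder ι] (α : ι → ℕ) (a : Hall R)
    (r : ℕ) :
    coeff R (cls R (CyclicSum R α)) (a * uElt R (ones r)) =
      ∑ I : Finset ι, if I.card = r ∧ ∀ i ∈ I, 0 < α i then
        (Nat.card (ResidueField R) : ℤ) ^ cellDim α I * coeff R (cls R (CyclicSum R (lower α I))) a
      else 0 := by
  obtain ⟨p, hp⟩ := IsDiscreteValuationRing.exists_irreducible R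
  have := Fintype.ofFinite (ResidueField R)
  obtain ⟨e⟩ := nonempty_typeModule_ones_equiv R r
  let F : (Σ I : {I : Finset ι // I.card = r ∧ ∀ i ∈ I, 0 < α i},
        {C : ι × ι → ResidueField R // IsEchelon (RowLT α) I.1 C}) →
      {A : Submodule R (CyclicSum R α) // cls R A = cls R (TypeModule R (ones r))} := fun x =>
    ⟨LinearMap.ker (cellMap hp α x.1.1 x.2.1), by
      obtain ⟨e'⟩ := nonempty_ker_cellMap_equiv hp x.2.2 x.1.2.2
      rw [x.1.2.1] at e'
      exact cls_congr R (e'.trans e.symm)⟩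
  have hF : Function.Bijective F := by
    constructor
    · rintro ⟨⟨I, hI⟩, ⟨C, hC⟩⟩ ⟨⟨I', hI'⟩, ⟨C', hC'⟩⟩ h
      obtain ⟨rfl, rfl⟩ := ker_cellMap_injective hp hC hI.2 hC' hI'.2 (congrArg Subtype.val h)
      rfl
    · rintro ⟨A, hA⟩
      obtain ⟨e'⟩ := (cls_eq_iff R).1 hA
      let f := e'.trans e
      have hpA : ∀ x ∈ A, p • x = 0 := by
        intro x hx
        have h1 : p • f ⟨x, hx⟩ = 0 := by
          ext i
          obtain ⟨y, hy⟩ := residue_surjective (f ⟨x, hx⟩ i)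
          rw [Pi.smul_apply, ← hy]
          exact (residue_eq_zero_iff _).2 (Ideal.mul_mem_right _ _
            ((mem_maximalIdeal p).2 hp.not_isUnit))
        rw [← map_smul, LinearEquiv.map_eq_zero_iff] at h1
        exact congrArg Subtype.val h1
      obtain ⟨I, C, hC, hI, rfl⟩ := exists_eq_ker_cellMap hp A hpA
      obtain ⟨e''⟩ := nonempty_ker_cellMap_equiv hp hC hI
      have hcard : I.card = r := by
        have h1 := Nat.card_congr (e''.symm.trans f).toEquiv
        simp only [Nat.card_fun, Nat.card_fin] at h1
        exact Nat.pow_right_injective (Finite.one_lt_card (α := ResidueField R)) h1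
      exact ⟨⟨⟨I, hcard, hI⟩, ⟨C, hC⟩⟩, rfl⟩
  rw [uElt, coeff_mul_basisElt, ← (Equiv.ofBijective F hF).sum_comp, Fintype.sum_sigma,
    ← Finset.sum_filter]
  have h1 : ∀ (I : {I : Finset ι // I.card = r ∧ ∀ i ∈ I, 0 < α i}),
      ∑ C : {C : ι × ι → ResidueField R // IsEchelon (RowLT α) I.1 C},
        coeff R (cls R (CyclicSum R α ⧸ (Equiv.ofBijective F hF ⟨I, C⟩).1)) a =
      (Nat.card (ResidueField R) : ℤ) ^ cellDim α I.1 *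
        coeff R (cls R (CyclicSum R (lower α I.1))) a := by
    intro I
    have h2 : ∀ C : {C : ι × ι → ResidueField R // IsEchelon (RowLT α) I.1 C},
        cls R (CyclicSum R α ⧸ (Equiv.ofBijective F hF ⟨I, C⟩).1) =
          cls R (CyclicSum R (lower α I.1)) := fun C =>
      cls_congr R (LinearMap.quotKerEquivOfSurjective _ (cellMap_surjective hp C.2))
    simp only [h2]
    rw [Finset.sum_const, Finset.card_univ, ← Nat.card_eq_fintype_card, card_isEchelon,
      nsmul_eq_mul, Nat.cast_pow]
    congr
  rw [Finset.sum_congr rfl fun I _ => h1 I]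
  exact (Finset.sum_subtype (Finset.univ.filter fun I : Finset ι => I.card = r ∧ ∀ i ∈ I, 0 < α i)
    (by simp) fun I => (Nat.card (ResidueField R) : ℤ) ^ cellDim α I *
        coeff R (cls R (CyclicSum R (lower α I))) a).symm

theorem coeff_cyclicSum_one {ι : Type} [Fintype ι] (α : ι → ℕ) :
    coeff R (cls R (CyclicSum R α)) 1 = open Classical in if ∀ i, α i = 0 then 1 else 0 := by
  classical
  rw [one_def, coeff_basisElt]
  refine if_congr ?_ rfl rfl
  rw [cls_eq_iff]
  constructor
  · rintro ⟨e⟩ i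
    by_contra h
    have hs : Subsingleton (CyclicSum R α) := e.symm.toEquiv.subsingleton
    have h1 : (fun _ => 1 : CyclicSum R α) i = (fun _ => 0 : CyclicSum R α) i := by
      rw [Subsingleton.elim (fun _ => 1 : CyclicSum R α) (fun _ => 0)]
    have h2 : Ideal.Quotient.mk (maximalIdeal R ^ α i) 1 = 0 := h1
    rw [Ideal.Quotient.eq_zero_iff_mem] at h2
    exact (maximalIdeal.isMaximal R).ne_top ((Ideal.eq_top_iff_one _).2 (Ideal.pow_le_self h h2))
  · intro h
    have : ∀ i, Subsingleton (R ⧸ maximalIdeal R ^ α i) := fun i =>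
      subsingleton_quotient_pow R (h i)
    exact ⟨LinearEquiv.ofSubsingleton _ _⟩

end Recursion

/-! ### Products of classes of elementary modules -/

section Unroll

variable {ι : Type}

open Classical in
/-- For a sequence of sets of rows, the number of the sets with index at most `l` that contain the
row `i`: the lengths of the rows once the labels `0, …, l` have been placed. -/
noncomputable def partialShape {s : ℕ} (T : Fin s → Finset ι) (l : ℕ) (i : ι) : ℕ :=
  (Finset.univ.filter fun k : Fin s => (k : ℕ) ≤ l ∧ i ∈ T k).card

open Classical in
/-- The number of sets of a sequence that contain the row `i`. -/
noncomputable def rowCount {s : ℕ} (T : Fin s → Finset ι) (i : ι) : ℕ :=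
  (Finset.univ.filter fun k : Fin s => i ∈ T k).card

/-- The dimension of the cell of flags labelled by a sequence of sets of rows. -/
noncomputable def flagDim [Fintype ι] [LinearOrder ι] {s : ℕ} (T : Fin s → Finset ι) : ℕ :=
  ∑ l : Fin s, cellDim (partialShape T l) (T l)

/-- The sequence `T` extended by the set `I`. -/
def snocSet {s : ℕ} (T : Fin s → Finset ι) (I : Finset ι) : Fin (s + 1) → Finset ι :=
  Fin.snoc (α := fun _ => Finset ι) T I

theorem snocSet_castSucc {s : ℕ} (T : Fin s → Finset ι) (I : Finset ι) (l : Fin s) :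
    snocSet T I l.castSucc = T l :=
  Fin.snoc_castSucc (α := fun _ => Finset ι) I T l

theorem snocSet_last {s : ℕ} (T : Fin s → Finset ι) (I : Finset ι) :
    snocSet T I (Fin.last s) = I :=
  Fin.snoc_last (α := fun _ => Finset ι) I T

theorem partialShape_snoc {s : ℕ} (T : Fin s → Finset ι) (I : Finset ι) (l : Fin s) :
    partialShape (snocSet T I) l = partialShape T l := by
  classical
  ext i
  have h : ¬ s ≤ (l : ℕ) := by omega
  simp only [partialShape, Finset.card_filter, Fin.sum_univ_castSucc, Fin.val_castSucc,
    Fin.val_last, h, false_and, if_false, add_zero]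
  exact Finset.sum_congr rfl fun k _ => if_congr (by rw [snocSet_castSucc]) rfl rfl

theorem partialShape_last {s : ℕ} (T : Fin (s + 1) → Finset ι) (i : ι) :
    partialShape T s i = rowCount T i := by
  rw [partialShape, rowCount]
  congr 1
  ext k
  have : (k : ℕ) ≤ s := by omega
  simp [this]

theorem flagDim_snoc [Fintype ι] [LinearOrder ι] {s : ℕ} (T : Fin s → Finset ι) (I : Finset ι) :
    flagDim (snocSet T I) =
      flagDim T + cellDim (partialShape (snocSet T I) s) I := by
  simp only [flagDim, Fin.sum_univ_castSucc, snocSet_castSucc, snocSet_last, Fin.val_last,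
    Fin.val_castSucc, partialShape_snoc]

open Classical in
theorem rowCount_snoc {s : ℕ} (T : Fin s → Finset ι) (I : Finset ι) (i : ι) :
    rowCount (snocSet T I) i =
      rowCount T i + if i ∈ I then 1 else 0 := by
  simp only [rowCount, Finset.card_filter, Fin.sum_univ_castSucc]
  refine congrArg₂ _ (Finset.sum_congr rfl fun k _ => if_congr ?_ rfl rfl) (if_congr ?_ rfl rfl)
  · rw [snocSet_castSucc]
  · rw [snocSet_last]

variable {R : Type u} [CommRing R] [IsDomain R] [IsDiscreteValuationRing R]
  [Finite (ResidueField R)]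

open Classical in
/-- The coefficients of a product of classes of elementary modules, as a sum over the sequences of
sets of rows. -/
theorem coeff_cyclicSum_prod_ones [Fintype ι] [LinearOrder ι] (w : ℕ → ℕ) (s : ℕ) (α : ι → ℕ) :
    coeff R (cls R (CyclicSum R α)) ((List.range s).map fun k => uElt R (ones (w k))).prod =
      ∑ T : Fin s → Finset ι,
        if (∀ l, (T l).card = w l) ∧ ∀ i, rowCount T i = α i then
          (Nat.card (ResidueField R) : ℤ) ^ flagDim T else 0 := by
  induction s generalizing α with
  | zero =>
    rw [List.range_zero, List.map_nil, List.prod_nil, coeff_cyclicSum_one,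
      Fintype.sum_eq_single (fun _ => ∅) (fun T h => absurd (Subsingleton.elim _ _) h)]
    simp [flagDim, rowCount, eq_comm]
  | succ s ih =>
    rw [List.range_succ, List.map_append, List.prod_append, List.map_singleton, List.prod_singleton,
      coeff_cyclicSum_mul_ones, ← (Fin.snocEquiv fun _ => Finset ι).sum_comp,
      Fintype.sum_prod_type]
    refine Finset.sum_congr rfl fun I _ => ?_
    rw [ih, Finset.mul_sum]
    have h0 : ∀ T : Fin s → Finset ι,
        ((∀ l, ((Fin.snocEquiv fun _ => Finset ι) (I, T) l).card = w l) ∧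
          ∀ i, rowCount ((Fin.snocEquiv fun _ => Finset ι) (I, T)) i = α i) ↔
        (I.card = w s ∧ ∀ i ∈ I, 0 < α i) ∧ (∀ l, (T l).card = w l) ∧
          ∀ i, rowCount T i = lower α I i := by
      intro T
      have h1 : ∀ i, rowCount ((Fin.snocEquiv fun _ => Finset ι) (I, T)) i =
            rowCount T i + if i ∈ I then 1 else 0 :=
        fun i => (rowCount_snoc T I i).trans (by congr)
      have h2 : ∀ l, (Fin.snocEquiv fun _ => Finset ι) (I, T) l = snocSet T I l := fun _ => rfl
      simp only [h1]
      simp only [h2, Fin.forall_fin_succ', snocSet_castSucc, snocSet_last, Fin.val_castSucc,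
        Fin.val_last]
      constructor
      · rintro ⟨⟨h2, h3⟩, h4⟩
        refine ⟨⟨h3, fun i hi => ?_⟩, h2, fun i => ?_⟩
        · rw [← h4 i, if_pos hi]
          omega
        · rw [lower, ← h4 i]
          split_ifs <;> simp
      · rintro ⟨⟨h2, h3⟩, h4, h5⟩
        refine ⟨⟨h4, h2⟩, fun i => ?_⟩
        rw [h5 i, lower]
        split_ifs with hi
        · have := h3 i hi
          omega
        · rfl
    by_cases hI : I.card = w s ∧ ∀ i ∈ I, 0 < α i
    · rw [if_pos hI]
      refine Finset.sum_congr rfl fun T _ => ?_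
      rw [mul_ite, mul_zero]
      refine (ite_congr (propext ((h0 T).trans (and_iff_right hI))) (fun h => ?_) fun _ => rfl).symm
      have h2 := ((h0 T).2 ⟨hI, h⟩).2
      have h3 : partialShape (snocSet T I) s = α := by
        ext i
        rw [partialShape_last]
        exact h2 i
      have h4 := flagDim_snoc T I
      rw [h3] at h4
      have h5 : flagDim ((Fin.snocEquiv fun _ => Finset ι) (I, T)) = flagDim T + cellDim α I := h4
      rw [h5, pow_add, mul_comm]
    · rw [if_neg hI]
      refine (Finset.sum_eq_zero fun T _ => if_neg fun h => hI ((h0 T).1 h).1).symm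

end Unroll

/-! ### Row-strict arrays and sequences of sets of rows -/

section Arrays

variable {μ : YoungDiagram}

/-- The entry of an array in row `i` and column `j`, with the labels numbered from `0`, and the
value `0` outside the diagram. -/
def CellArray.label (A : CellArray μ) (i j : ℕ) : ℕ :=
  if h : (i, j) ∈ μ.cells then (A ⟨(i, j), h⟩).natPred else 0

theorem CellArray.apply_eq (A : CellArray μ) (x : μ.cells) :
    A x = (A.label x.1.1 x.1.2).succPNat := by
  obtain ⟨⟨i, j⟩, h⟩ := x
  simp [CellArray.label, h]

theorem CellArray.ext_apply (A : CellArray μ) (x : μ.cells) :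
    A.ext x = ((A.label x.1.1 x.1.2).succPNat : WithTop ℕ+) := by
  rw [← A.apply_eq, CellArray.ext, dif_pos x.2]

theorem mem_cells_iff {i j : ℕ} : (i, j) ∈ μ.cells ↔ j < μ.rowLen i := by
  rw [YoungDiagram.mem_cells, YoungDiagram.mem_iff_lt_rowLen]

theorem CellArray.ext_lt_ext_right (A : CellArray μ) (x : μ.cells) (m : ℕ) :
    (m.succPNat : WithTop ℕ+) < A.ext (right x) ↔
      (x.1.2 + 1 < μ.rowLen x.1.1 → m < A.label x.1.1 (x.1.2 + 1)) := by
  by_cases h : right x ∈ μ.cells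
  · have h1 := A.ext_apply ⟨right x, h⟩
    have h2 : x.1.2 + 1 < μ.rowLen x.1.1 := mem_cells_iff.1 h
    rw [h1, WithTop.coe_lt_coe, Nat.succPNat_lt_succPNat]
    exact ⟨fun h _ => h, fun h => h h2⟩
  · have h2 : ¬ x.1.2 + 1 < μ.rowLen x.1.1 := fun h2 => h (mem_cells_iff.2 h2)
    rw [CellArray.ext, dif_neg h]
    exact ⟨fun _ h => absurd h h2, fun _ => WithTop.coe_lt_top _⟩

theorem CellArray.rowStrict_iff (A : CellArray μ) :
    A.RowStrict ↔ ∀ i j, j + 1 < μ.rowLen i → A.label i j < A.label i (j + 1) := by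
  constructor
  · intro h i j hij
    have h1 := h ⟨(i, j), mem_cells_iff.2 (by omega)⟩
    rw [A.ext_apply, A.ext_lt_ext_right] at h1
    exact h1 hij
  · intro h x
    rw [A.ext_apply, A.ext_lt_ext_right]
    exact h _ _

theorem CellArray.RowStrict.label_lt {A : CellArray μ} (hA : A.RowStrict) {i j j' : ℕ} (h : j < j')
    (hj' : j' < μ.rowLen i) : A.label i j < A.label i j' := by
  rw [A.rowStrict_iff] at hA
  induction j', h using Nat.le_induction with
  | base => exact hA i j hj'
  | succ k hk ih => exact (ih (by omega)).trans (hA i k hj')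

theorem CellArray.RowStrict.label_inj {A : CellArray μ} (hA : A.RowStrict) {i j j' : ℕ}
    (hj : j < μ.rowLen i) (hj' : j' < μ.rowLen i) (h : A.label i j = A.label i j') : j = j' := by
  rcases lt_trichotomy j j' with h1 | h1 | h1
  · exact absurd h (hA.label_lt h1 hj').ne
  · exact h1
  · exact absurd h (hA.label_lt h1 hj).ne'

open Classical in
/-- The set of the rows of an array that contain the label `l`. -/
noncomputable def rowSets (A : CellArray μ) (s : ℕ) (l : Fin s) : Finset (Fin (μ.colLen 0)) :=
  Finset.univ.filter fun i => ∃ j, j < μ.rowLen i ∧ A.label i j = l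

theorem mem_rowSets {A : CellArray μ} {s : ℕ} {l : Fin s} {i : Fin (μ.colLen 0)} :
    i ∈ rowSets A s l ↔ ∃ j, j < μ.rowLen i ∧ A.label i j = l := by
  simp [rowSets]

theorem lt_colLen_of_lt_rowLen {i j : ℕ} (h : j < μ.rowLen i) : i < μ.colLen 0 := by
  rw [← YoungDiagram.mem_iff_lt_colLen, YoungDiagram.mem_iff_lt_rowLen]
  omega

/-- In a row-strict array, the rows that contain a label are in bijection with its occurrences. -/
theorem CellArray.RowStrict.card_rowSets {A : CellArray μ} (hA : A.RowStrict) {s : ℕ} (l : Fin s) :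
    (rowSets A s l).card =
      (Finset.univ.filter fun x : μ.cells => A x = (l : ℕ).succPNat).card := by
  have hlt : ∀ x : μ.cells, x.1.2 < μ.rowLen x.1.1 := fun x => mem_cells_iff.1 x.2
  refine (Finset.card_bij (fun x _ => ⟨x.1.1, lt_colLen_of_lt_rowLen (hlt x)⟩) ?_ ?_ ?_).symm
  · intro x hx
    rw [Finset.mem_filter, A.apply_eq, Nat.succPNat_inj] at hx
    exact mem_rowSets.2 ⟨x.1.2, hlt x, hx.2⟩
  · intro x hx y hy hxy
    rw [Finset.mem_filter, A.apply_eq, Nat.succPNat_inj] at hx hy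
    have h1 : x.1.1 = y.1.1 := congrArg Fin.val hxy
    have h2 := hlt x
    have h3 := hlt y
    rw [h1] at hx h2
    exact Subtype.ext (Prod.ext h1 (hA.label_inj h2 h3 (hx.2.trans hy.2.symm)))
  · intro i hi
    obtain ⟨j, hj, hl⟩ := mem_rowSets.1 hi
    refine ⟨⟨(i, j), mem_cells_iff.2 hj⟩, ?_, rfl⟩
    rw [Finset.mem_filter, A.apply_eq]
    exact ⟨Finset.mem_univ _, congrArg Nat.succPNat hl⟩

variable {A : CellArray μ} {s : ℕ}

theorem partialShape_rowSets (hA : A.RowStrict) (hs : ∀ i j, j < μ.rowLen i → A.label i j < s)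
    (i : Fin (μ.colLen 0)) (l : ℕ) :
    partialShape (rowSets A s) l i =
      ((Finset.range (μ.rowLen i)).filter fun j => A.label i j ≤ l).card := by
  have h : partialShape (rowSets A s) l i =
      (Finset.univ.filter fun k : Fin s => (k : ℕ) ≤ l ∧ i ∈ rowSets A s k).card := by
    unfold partialShape
    congr
  rw [h]
  symm
  refine Finset.card_bij (fun j hj => ⟨A.label i j, hs i j ?_⟩) ?_ ?_ ?_
  · exact Finset.mem_range.1 (Finset.mem_filter.1 hj).1
  · intro j hj
    rw [Finset.mem_filter, Finset.mem_range] at hj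
    exact Finset.mem_filter.2 ⟨Finset.mem_univ _, hj.2, mem_rowSets.2 ⟨j, hj.1, rfl⟩⟩
  · intro j hj j' hj' h
    rw [Finset.mem_filter, Finset.mem_range] at hj hj'
    exact hA.label_inj hj.1 hj'.1 (congrArg Fin.val h)
  · intro k hk
    obtain ⟨-, hkl, hk⟩ := Finset.mem_filter.1 hk
    obtain ⟨j, hj, hjk⟩ := mem_rowSets.1 hk
    refine ⟨j, ?_, Fin.ext hjk⟩
    rw [Finset.mem_filter, Finset.mem_range]
    exact ⟨hj, hjk ▸ hkl⟩

theorem partialShape_rowSets_le (hA : A.RowStrict)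
    (hs : ∀ i j, j < μ.rowLen i → A.label i j < s) (i : Fin (μ.colLen 0)) (l : ℕ) :
    partialShape (rowSets A s) l i ≤ μ.rowLen i := by
  rw [partialShape_rowSets hA hs]
  exact (Finset.card_filter_le _ _).trans (Finset.card_range _).le

/-- The entries of row `i` that are at most `l` are those in the first `partialShape _ l i`
columns. -/
theorem label_le_iff (hA : A.RowStrict) (hs : ∀ i j, j < μ.rowLen i → A.label i j < s)
    {i : Fin (μ.colLen 0)} {l j : ℕ} (hj : j < μ.rowLen i) :
    A.label i j ≤ l ↔ j < partialShape (rowSets A s) l i := by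
  rw [partialShape_rowSets hA hs]
  constructor
  · intro h
    rw [← Nat.succ_le_iff, ← Finset.card_range j.succ]
    refine Finset.card_le_card fun k hk => ?_
    rw [Finset.mem_range, Nat.lt_succ_iff] at hk
    rw [Finset.mem_filter, Finset.mem_range]
    refine ⟨by omega, le_trans ?_ h⟩
    rcases hk.eq_or_lt with rfl | h1
    · exact le_rfl
    · exact (hA.label_lt h1 hj).le
  · intro h
    by_contra h1
    refine absurd h (not_lt.2 ?_)
    rw [← Finset.card_range j]
    refine Finset.card_le_card fun k hk => ?_
    rw [Finset.mem_filter, Finset.mem_range] at hk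
    rw [Finset.mem_range]
    by_contra h2
    rcases (not_lt.1 h2).eq_or_lt with rfl | h3
    · exact h1 hk.2
    · exact h1 ((hA.label_lt h3 hk.1).le.trans hk.2)

theorem partialShape_eq_of_label (hA : A.RowStrict)
    (hs : ∀ i j, j < μ.rowLen i → A.label i j < s) {i : Fin (μ.colLen 0)} {l j : ℕ}
    (hj : j < μ.rowLen i) (h : A.label i j ≤ l)
    (h' : j + 1 < μ.rowLen i → l < A.label i (j + 1)) :
    partialShape (rowSets A s) l i = j + 1 := by
  have h1 := (label_le_iff hA hs hj).1 h
  have h2 := partialShape_rowSets_le hA hs i l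
  by_cases h3 : j + 1 < μ.rowLen i
  · have h4 := mt (label_le_iff hA hs h3).2 (not_le.2 (h' h3))
    omega
  · omega

theorem rowCount_rowSets (hA : A.RowStrict) (hs : ∀ i j, j < μ.rowLen i → A.label i j < s)
    (i : Fin (μ.colLen 0)) :
    rowCount (rowSets A s) i = μ.rowLen i := by
  have h := partialShape_rowSets hA hs i s
  rw [Finset.filter_true_of_mem, Finset.card_range] at h
  · rw [← h, rowCount, partialShape]
    congr 1
    ext k
    simp
  · intro j hj
    exact (hs i j (Finset.mem_range.1 hj)).le

theorem eq_of_rowSets_eq {A' : CellArray μ} (hA : A.RowStrict) (hA' : A'.RowStrict)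
    (hs : ∀ i j, j < μ.rowLen i → A.label i j < s)
    (hs' : ∀ i j, j < μ.rowLen i → A'.label i j < s) (h : rowSets A s = rowSets A' s) : A = A' := by
  funext x
  have hx : x.1.2 < μ.rowLen x.1.1 := mem_cells_iff.1 x.2
  have key : ∀ l, A.label x.1.1 x.1.2 ≤ l ↔ A'.label x.1.1 x.1.2 ≤ l := fun l =>
    (label_le_iff hA hs (i := ⟨x.1.1, lt_colLen_of_lt_rowLen hx⟩) hx).trans
      ((iff_of_eq (by rw [h])).trans
        (label_le_iff hA' hs' (i := ⟨x.1.1, lt_colLen_of_lt_rowLen hx⟩) hx).symm)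
  rw [A.apply_eq, A'.apply_eq, le_antisymm ((key _).2 le_rfl) ((key _).1 le_rfl)]

/-- A pair of cells `(x, y)` that Zelevinsky's statistic counts is determined by the label `l` of
`y` and by the rows of `y` and `x`, since `x` and `y` are the last cells with label at most `l` in
their rows. -/
theorem zelevinsky_eq_flagDim (hA : A.RowStrict)
    (hs : ∀ i j, j < μ.rowLen i → A.label i j < s) : A.zelevinsky = flagDim (rowSets A s) := by
  classical
  have hlt : ∀ x : μ.cells, x.1.2 < μ.rowLen x.1.1 := fun x => mem_cells_iff.1 x.2
  let row : μ.cells → Fin (μ.colLen 0) := fun x => ⟨x.1.1, lt_colLen_of_lt_rowLen (hlt x)⟩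
  let P : μ.cells × μ.cells → Prop := fun p =>
    CellLT p.2 p.1 ∧ A.ext p.1 < A.ext p.2 ∧ A.ext p.2 < A.ext (right p.1)
  let lab : μ.cells → Fin s := fun y => ⟨A.label y.1.1 y.1.2, hs _ _ (hlt y)⟩
  have hP : ∀ p, P p ↔ (p.2.1.2 < p.1.1.2 ∨ p.2.1.2 = p.1.1.2 ∧ p.1.1.1 < p.2.1.1) ∧
      A.label p.1.1.1 p.1.1.2 < A.label p.2.1.1 p.2.1.2 ∧
      (p.1.1.2 + 1 < μ.rowLen p.1.1.1 →
        A.label p.2.1.1 p.2.1.2 < A.label p.1.1.1 (p.1.1.2 + 1)) := by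
    intro p
    simp only [P, A.ext_apply, A.ext_lt_ext_right, WithTop.coe_lt_coe, Nat.succPNat_lt_succPNat]
    rfl
  -- Once the labels up to that of `y` are placed, `y` is the end of its row, and so is `x` for each
  -- counted pair `(x, y)`.
  have hy : ∀ y : μ.cells, partialShape (rowSets A s) (lab y) (row y) = y.1.2 + 1 := fun y =>
    partialShape_eq_of_label hA hs (hlt y) le_rfl fun h => hA.label_lt (Nat.lt_succ_self _) h
  have hx : ∀ p, P p → partialShape (rowSets A s) (lab p.2) (row p.1) = p.1.1.2 + 1 := fun p hp =>
    partialShape_eq_of_label hA hs (hlt p.1) ((hP p).1 hp).2.1.le ((hP p).1 hp).2.2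
  have hmem : ∀ y : μ.cells, row y ∈ rowSets A s (lab y) := fun y =>
    mem_rowSets.2 ⟨y.1.2, hlt y, rfl⟩
  have hnot : ∀ p, P p → row p.1 ∉ rowSets A s (lab p.2) := by
    intro p hp h
    obtain ⟨j, hj, hjl⟩ := mem_rowSets.1 h
    have h1 := ((hP p).1 hp).2
    have h2 : A.label p.1.1.1 j = A.label p.2.1.1 p.2.1.2 := hjl
    rw [← h2] at h1
    have hj' : j < μ.rowLen p.1.1.1 := hj
    rcases lt_trichotomy j p.1.1.2 with h3 | h3 | h3
    · exact lt_asymm h1.1 (hA.label_lt h3 (hlt p.1))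
    · exact h1.1.ne (h3 ▸ rfl)
    · have h4 := h1.2 (by omega)
      rcases (Nat.succ_le_iff.2 h3).eq_or_lt with h5 | h5
      · exact h4.ne (h5 ▸ rfl)
      · exact lt_asymm h4 (hA.label_lt h5 hj')
  have hcard : ∀ l : Fin s, cellDim (partialShape (rowSets A s) l) (rowSets A s l) =
      Nat.card {q : Fin (μ.colLen 0) × Fin (μ.colLen 0) // q.1 ∈ rowSets A s l ∧
        q.2 ∉ rowSets A s l ∧ RowLT (partialShape (rowSets A s) l) q.1 q.2} := by
    intro l
    rw [cellDim, Nat.card_eq_fintype_card, Fintype.card_subtype]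
  rw [flagDim, Finset.sum_congr rfl fun l _ => hcard l, ← Nat.card_sigma]
  let F : {p // P p} → (Σ l : Fin s, {q : Fin (μ.colLen 0) × Fin (μ.colLen 0) //
      q.1 ∈ rowSets A s l ∧ q.2 ∉ rowSets A s l ∧
        RowLT (partialShape (rowSets A s) l) q.1 q.2}) := fun p =>
    ⟨lab p.1.2, (row p.1.2, row p.1.1), hmem _, hnot _ p.2, by
      have h1 := ((hP p.1).1 p.2).1
      rw [RowLT, hy, hx _ p.2]
      rcases h1 with h1 | h1
      · exact Or.inl (by omega)
      · exact Or.inr ⟨by omega, h1.2⟩⟩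
  refine Nat.card_congr (Equiv.ofBijective F ⟨?_, ?_⟩)
  · rintro ⟨p, hp⟩ ⟨p', hp'⟩ h
    have hl : lab p.2 = lab p'.2 := congrArg Sigma.fst h
    have hq : ∀ {z z' : Σ l : Fin s, {q : Fin (μ.colLen 0) × Fin (μ.colLen 0) //
      q.1 ∈ rowSets A s l ∧ q.2 ∉ rowSets A s l ∧
        RowLT (partialShape (rowSets A s) l) q.1 q.2}}, z = z' → z.2.1 = z'.2.1 := by
      rintro z _ rfl
      rfl
    have hr := hq h
    have hr1 : row p.2 = row p'.2 := congrArg Prod.fst hr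
    have hr2 : row p.1 = row p'.1 := congrArg Prod.snd hr
    have h1 := hy p.2
    have h2 := hx p hp
    rw [hl, hr1, hy] at h1
    rw [hl, hr2, hx p' hp'] at h2
    refine Subtype.ext (Prod.ext (Subtype.ext (Prod.ext ?_ ?_)) (Subtype.ext (Prod.ext ?_ ?_)))
    · exact congrArg Fin.val hr2
    · exact (Nat.succ_injective h2).symm
    · exact congrArg Fin.val hr1
    · exact (Nat.succ_injective h1).symm
  · rintro ⟨l, ⟨⟨j, i⟩, hj, hi, hr⟩⟩
    obtain ⟨b, hb, hbl⟩ := mem_rowSets.1 hj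
    have hb1 : partialShape (rowSets A s) l j = b + 1 :=
      partialShape_eq_of_label hA hs hb hbl.le fun h => hbl ▸ hA.label_lt (Nat.lt_succ_self _) h
    have hle : b + 1 ≤ partialShape (rowSets A s) l i := hb1 ▸ hr.le
    obtain ⟨a, ha⟩ : ∃ a, partialShape (rowSets A s) l i = a + 1 :=
      Nat.exists_eq_succ_of_ne_zero (by omega)
    have ha1 : a < μ.rowLen i := by
      have := partialShape_rowSets_le hA hs i l
      omega
    have ha2 : A.label i a ≤ l := (label_le_iff hA hs ha1).2 (by omega)
    have ha3 : A.label i a ≠ l := fun h => hi (mem_rowSets.2 ⟨a, ha1, h⟩)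
    have hp : P (⟨(i, a), mem_cells_iff.2 ha1⟩, ⟨(j, b), mem_cells_iff.2 hb⟩) := by
      rw [hP]
      refine ⟨?_, ?_, ?_⟩
      · rw [RowLT, ha, hb1] at hr
        rcases hr with hr | hr
        · exact Or.inl (by simpa using hr)
        · exact Or.inr ⟨by simpa using hr.1, hr.2⟩
      · simp only [hbl]
        omega
      · intro h
        change a + 1 < μ.rowLen i at h
        have h1 := mt (label_le_iff hA hs (l := l) h).1 (by omega)
        change A.label j b < A.label i (a + 1)
        rw [show A.label j b = l from hbl]
        omega
    refine ⟨⟨_, hp⟩, ?_⟩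
    obtain rfl : lab ⟨(j, b), mem_cells_iff.2 hb⟩ = l := Fin.ext hbl
    rfl

open Classical in
/-- Every sequence of sets of rows that covers row `i` exactly `μ.rowLen i` times comes from a
row-strict array: row `i` lists the indices of the sets that contain it in increasing order. -/
theorem exists_rowSets_eq (T : Fin s → Finset (Fin (μ.colLen 0)))
    (hT : ∀ i, rowCount T i = μ.rowLen i) :
    ∃ A : CellArray μ, A.RowStrict ∧ (∀ i j, j < μ.rowLen i → A.label i j < s) ∧
      rowSets A s = T := by
  let f : ∀ i : Fin (μ.colLen 0), Fin (μ.rowLen i) ↪o Fin s := fun i =>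
    (Finset.univ.filter fun k => i ∈ T k).orderEmbOfFin (by
      rw [← hT i, rowCount]
      congr)
  let A : CellArray μ := fun x =>
    (f ⟨x.1.1, lt_colLen_of_lt_rowLen (mem_cells_iff.1 x.2)⟩
      ⟨x.1.2, mem_cells_iff.1 x.2⟩ : ℕ).succPNat
  have hA : ∀ i j (h : j < μ.rowLen i), A.label i j = f ⟨i, lt_colLen_of_lt_rowLen h⟩ ⟨j, h⟩ := by
    intro i j h
    rw [CellArray.label, dif_pos (mem_cells_iff.2 h)]
    simp [A]
  refine ⟨A, ?_, ?_, ?_⟩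
  · rw [A.rowStrict_iff]
    intro i j h
    rw [hA i j (by omega), hA i (j + 1) h]
    exact (f _).strictMono (Fin.mk_lt_mk.2 (Nat.lt_succ_self j))
  · intro i j h
    rw [hA i j h]
    exact Fin.is_lt _
  · ext l i
    have hr : l ∈ Set.range (f i) ↔ i ∈ T l := by
      rw [Finset.range_orderEmbOfFin]
      simp
    rw [mem_rowSets, ← hr]
    constructor
    · rintro ⟨j, hj, hjl⟩
      rw [hA i j hj] at hjl
      exact ⟨⟨j, hj⟩, Fin.ext hjl⟩
    · rintro ⟨⟨j, hj⟩, rfl⟩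
      exact ⟨j, hj, hA i j hj⟩

theorem label_lt_of_hasWeight {lam : YoungDiagram} (hA : A.HasWeight lam) {i j : ℕ}
    (h : j < μ.rowLen i) : A.label i j < lam.colLen 0 := by
  have h1 : 0 < lam.rowLen (A.label i j) := by
    rw [← hA, Finset.card_pos]
    exact ⟨⟨(i, j), mem_cells_iff.2 h⟩, by simp [A.apply_eq]⟩
  exact lt_colLen_of_lt_rowLen h1

theorem hasWeight_iff (hA : A.RowStrict) {lam : YoungDiagram}
    (hs : ∀ i j, j < μ.rowLen i → A.label i j < lam.colLen 0) :
    A.HasWeight lam ↔ ∀ l, (rowSets A (lam.colLen 0) l).card = lam.rowLen l := by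
  constructor
  · intro h l
    rw [hA.card_rowSets, h]
  · intro h k
    by_cases hk : k < lam.colLen 0
    · rw [← h ⟨k, hk⟩, hA.card_rowSets]
    · have h1 : lam.rowLen k = 0 := by
        by_contra h1
        exact hk (lt_colLen_of_lt_rowLen (Nat.pos_of_ne_zero h1))
      rw [h1, Finset.card_eq_zero, Finset.filter_eq_empty_iff]
      intro x _ hx
      rw [A.apply_eq, Nat.succPNat_inj] at hx
      exact hk (hx ▸ hs _ _ (mem_cells_iff.1 x.2))

open Classical in
/-- The sum over the row-strict arrays, rewritten as the sum over sequences of sets of rows that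
computes the coefficients in the Hall algebra. -/
theorem sum_rowStrictArrays (μ lam : YoungDiagram) (q : ℤ) :
    ∑ A ∈ rowStrictArrays μ lam, q ^ A.zelevinsky =
      ∑ T : Fin (lam.colLen 0) → Finset (Fin (μ.colLen 0)),
        if (∀ l, (T l).card = lam.rowLen l) ∧
          ∀ i, rowCount T i = μ.rowLen i then q ^ flagDim T else 0 := by
  have hmem : ∀ {A : CellArray μ}, A ∈ rowStrictArrays μ lam ↔ A.RowStrict ∧ A.HasWeight lam := by
    simp [rowStrictArrays]
  have hs : ∀ {A : CellArray μ}, A ∈ rowStrictArrays μ lam →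
      ∀ i j, j < μ.rowLen i → A.label i j < lam.colLen 0 :=
    fun hA i j h => label_lt_of_hasWeight (hmem.1 hA).2 h
  rw [← Finset.sum_filter]
  refine Finset.sum_bij (fun A _ => rowSets A (lam.colLen 0)) ?_ ?_ ?_ ?_
  · intro A hA
    rw [Finset.mem_filter]
    exact ⟨Finset.mem_univ _, (hasWeight_iff (hmem.1 hA).1 (hs hA)).1 (hmem.1 hA).2,
      rowCount_rowSets (hmem.1 hA).1 (hs hA)⟩
  · intro A hA A' hA' h
    exact eq_of_rowSets_eq (hmem.1 hA).1 (hmem.1 hA').1 (hs hA) (hs hA') h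
  · intro T hT
    rw [Finset.mem_filter] at hT
    obtain ⟨A, hA, hAs, rfl⟩ := exists_rowSets_eq T hT.2.2
    exact ⟨A, hmem.2 ⟨hA, (hasWeight_iff hA hAs).2 hT.2.1⟩, rfl⟩
  · intro A hA
    rw [zelevinsky_eq_flagDim (hmem.1 hA).1 (hs hA)]

end Arrays

/-! ### The classification of finite modules by partitions -/

section Classification

variable {R : Type u} [CommRing R] [IsDomain R] [IsDiscreteValuationRing R]

/-- Up to isomorphism, the direct sum does not change when its summands are permuted and the zero
summands are dropped. -/
theorem nonempty_cyclicSum_equiv {ι ι' : Type} {α : ι → ℕ} {β : ι' → ℕ} (e : ι' → ι)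
    (he : Function.Injective e) (hβ : ∀ i, α (e i) = β i) (h0 : ∀ i, i ∉ Set.range e → α i = 0) :
    Nonempty (CyclicSum R α ≃ₗ[R] CyclicSum R β) := by
  classical
  obtain rfl : (fun i => α (e i)) = β := funext hβ
  let f : CyclicSum R α →ₗ[R] CyclicSum R fun i => α (e i) :=
    LinearMap.pi fun i => LinearMap.proj (e i)
  refine ⟨LinearEquiv.ofBijective f ⟨fun x y h => ?_, fun y => ?_⟩⟩
  · ext i
    by_cases hi : i ∈ Set.range e
    · obtain ⟨j, rfl⟩ := hi
      exact congrFun h j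
    · have := subsingleton_quotient_pow R (h0 i hi)
      exact Subsingleton.elim _ _
  · refine ⟨fun i => if h : ∃ j, e j = i then h.choose_spec ▸ y h.choose else 0, ?_⟩
    ext j
    have key : ∀ (j' : ι') (h : e j' = e j),
        (h ▸ y j' : R ⧸ maximalIdeal R ^ α (e j)) = y j := by
      intro j' h
      obtain rfl := he h
      rfl
    have hj : ∃ j', e j' = e j := ⟨j, rfl⟩
    exact (dif_pos hj).trans (key _ hj.choose_spec)

/-- Every finite module over a discrete valuation ring is of type `μ` for some partition `μ`. -/
theorem exists_typeModule_equiv (M : Type u) [AddCommGroup M] [Module R M] [Finite M] :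
    ∃ μ : YoungDiagram, Nonempty (M ≃ₗ[R] TypeModule R μ) := by
  classical
  obtain ⟨p, hp⟩ := IsDiscreteValuationRing.exists_irreducible R
  have htor : Module.IsTorsion' M (Submonoid.powers p) := by
    rw [Submodule.isTorsion'_powers_iff]
    exact fun x => ⟨Nat.card M, pow_maximalIdeal_smul_eq_zero R M
      ((mem_maximalIdeal_pow hp).2 dvd_rfl) x⟩
  obtain ⟨d, k, ⟨e₁⟩⟩ := Module.torsion_by_prime_power_decomposition hp htor
  have e₂ : (DirectSum (Fin d) fun i => R ⧸ Submodule.span R {p ^ k i}) ≃ₗ[R] CyclicSum R k :=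
    (DirectSum.linearEquivFunOnFintype R (Fin d) fun i => R ⧸ Submodule.span R {p ^ k i}).trans
      (LinearEquiv.piCongrRight fun i => Submodule.quotEquivOfEq _ (maximalIdeal R ^ k i)
        (by rw [hp.maximalIdeal_eq, Ideal.span_singleton_pow]))
  -- Sorting the exponents in decreasing order gives the rows of `μ`, followed by zeros.
  let σ : Equiv.Perm (Fin d) := Tuple.sort fun i => OrderDual.toDual (k i)
  have hanti : Antitone fun i => k (σ i) := Tuple.monotone_sort fun i => OrderDual.toDual (k i)
  let μ : YoungDiagram := YoungDiagram.ofRowLens (List.ofFn fun i => k (σ i))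
    (List.sortedGE_ofFn_iff.2 hanti)
  have hrow : ∀ i : Fin d, μ.rowLen i = k (σ i) := by
    intro i
    have h := YoungDiagram.rowLen_ofRowLens (hw := List.sortedGE_ofFn_iff.2 hanti)
      (Fin.cast (List.length_ofFn (f := fun i => k (σ i))).symm i)
    simpa using h
  have hcol : ∀ i, i < μ.colLen 0 → i < d := by
    intro i hi
    rw [← YoungDiagram.mem_iff_lt_colLen, YoungDiagram.mem_ofRowLens] at hi
    simpa using hi.1
  obtain ⟨e₃⟩ := nonempty_cyclicSum_equiv (R := R) (α := k)
    (β := fun i : Fin (μ.colLen 0) => μ.rowLen i) (fun i => σ ⟨i, hcol i i.2⟩)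
    (fun i j h => Fin.ext (Fin.mk_eq_mk.1 (σ.injective h)))
    (fun i => (hrow ⟨i, hcol i i.2⟩).symm) (fun i hi => by
      by_contra h
      refine hi ⟨⟨σ.symm i, ?_⟩, σ.apply_symm_apply i⟩
      refine lt_colLen_of_lt_rowLen (j := 0) ?_
      rw [hrow, σ.apply_symm_apply]
      omega)
  exact ⟨μ, ⟨e₁.trans (e₂.trans e₃)⟩⟩

/-- The number of elements killed by `p` and divisible by `p ^ k` counts the cyclic summands of
length greater than `k`. -/
theorem card_socle_inter_pow [Finite (ResidueField R)] {p : R} (hp : Irreducible p) {ι : Type}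
    [Fintype ι] (α : ι → ℕ) (k : ℕ) :
    Nat.card {x : CyclicSum R α // p • x = 0 ∧ ∃ y, p ^ k • y = x} =
      Nat.card (ResidueField R) ^ (Finset.univ.filter fun i => k < α i).card := by
  classical
  have hex : ∀ i, k < α i → ∀ t, ∃ y, p ^ k • y = socleMap hp (α i) t := by
    intro i hi t
    obtain ⟨x, rfl⟩ := residue_surjective t
    refine ⟨Ideal.Quotient.mk _ (p ^ (α i - 1 - k) * x), ?_⟩
    rw [socleMap_residue]
    have h : p ^ (α i - 1) = p ^ k * p ^ (α i - 1 - k) := by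
      rw [← pow_add]
      congr 1
      omega
    rw [h, mul_assoc]
    rfl
  choose! y hy using hex
  let F : ({i // k < α i} → ResidueField R) →
      {x : CyclicSum R α // p • x = 0 ∧ ∃ y, p ^ k • y = x} := fun w =>
    ⟨fun i => if h : k < α i then socleMap hp (α i) (w ⟨i, h⟩) else 0, by
      ext i
      rw [Pi.smul_apply]
      split_ifs
      · exact smul_socleMap hp _ _
      · exact smul_zero _, fun i => if h : k < α i then y i (w ⟨i, h⟩) else 0, by
      ext i
      rw [Pi.smul_apply]
      split_ifs with h
      · exact hy i h _
      · exact smul_zero _⟩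
  have hF : Function.Bijective F := by
    constructor
    · intro w w' h
      ext ⟨i, hi⟩
      have h1 := congrFun (congrArg Subtype.val h) i
      simp only [F, hi, dif_pos] at h1
      exact socleMap_injective hp (by omega) h1
    · rintro ⟨x, hx, z, rfl⟩
      choose t ht using fun i => exists_socleMap_of_smul_eq_zero hp (congrFun hx i)
      refine ⟨fun i => t i, Subtype.ext (funext fun i => ?_)⟩
      simp only [F]
      split_ifs with h
      · exact ht i
      · obtain ⟨r, hr⟩ := Ideal.Quotient.mk_surjective (z i)
        rw [Pi.smul_apply, ← hr]
        symm
        change Ideal.Quotient.mk _ (p ^ k * r) = 0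
        rw [Ideal.Quotient.eq_zero_iff_mem, mem_maximalIdeal_pow hp]
        exact (pow_dvd_pow p (not_lt.1 h)).mul_right r
  rw [← Nat.card_congr (Equiv.ofBijective F hF), Nat.card_fun,
    Nat.card_eq_fintype_card (α := {i // _}), Fintype.card_subtype]

theorem card_lt_rowLen (μ : YoungDiagram) (k : ℕ) :
    (Finset.univ.filter fun i : Fin (μ.colLen 0) => k < μ.rowLen i).card = μ.colLen k := by
  have h : ∀ i : ℕ, k < μ.rowLen i ↔ i < μ.colLen k := fun i => by
    rw [← YoungDiagram.mem_iff_lt_rowLen, YoungDiagram.mem_iff_lt_colLen]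
  have hk := μ.colLen_anti 0 k (Nat.zero_le k)
  rw [← Finset.card_range (μ.colLen k)]
  refine Finset.card_bij (fun i _ => (i : ℕ)) ?_ (fun _ _ _ _ => Fin.ext) ?_
  · intro i hi
    exact Finset.mem_range.2 ((h i).1 (Finset.mem_filter.1 hi).2)
  · intro i hi
    rw [Finset.mem_range] at hi
    exact ⟨⟨i, hi.trans_le hk⟩, Finset.mem_filter.2 ⟨Finset.mem_univ _, (h i).2 hi⟩, rfl⟩

variable (R) [Finite (ResidueField R)]

theorem cls_typeModule_injective : Function.Injective fun μ => cls R (TypeModule R μ) := by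
  intro μ ν h
  obtain ⟨e⟩ := (cls_eq_iff R).1 h
  obtain ⟨p, hp⟩ := IsDiscreteValuationRing.exists_irreducible R
  have hcol : ∀ k, μ.colLen k = ν.colLen k := by
    intro k
    have h1 : Nat.card {x : TypeModule R μ // p • x = 0 ∧ ∃ y, p ^ k • y = x} =
        Nat.card {x : TypeModule R ν // p • x = 0 ∧ ∃ y, p ^ k • y = x} := by
      refine Nat.card_congr (e.toEquiv.subtypeEquiv fun x => and_congr ?_ ?_)
      · change _ ↔ p • e x = 0
        rw [← map_smul, LinearEquiv.map_eq_zero_iff]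
      · constructor
        · rintro ⟨y, rfl⟩
          exact ⟨e y, (map_smul e _ _).symm⟩
        · rintro ⟨y, hy⟩
          refine ⟨e.symm y, e.injective ?_⟩
          rw [map_smul, e.apply_symm_apply]
          exact hy
    rw [card_socle_inter_pow hp, card_socle_inter_pow hp, card_lt_rowLen, card_lt_rowLen] at h1
    exact Nat.pow_right_injective (Finite.one_lt_card (α := ResidueField R)) h1
  refine YoungDiagram.ext (Finset.ext fun ⟨i, j⟩ => ?_)
  rw [YoungDiagram.mem_cells, YoungDiagram.mem_cells, YoungDiagram.mem_iff_lt_colLen,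
    YoungDiagram.mem_iff_lt_colLen, hcol]

theorem cls_typeModule_surjective : Function.Surjective fun μ => cls R (TypeModule R μ) := by
  intro X
  rw [← cls_out R X]
  obtain ⟨μ, ⟨e⟩⟩ := exists_typeModule_equiv (R := R) (Quotient.out X).1
  exact ⟨μ, (cls_congr R e).symm⟩

theorem coeff_sum_uElt (b : YoungDiagram →₀ ℤ) (ν : YoungDiagram) :
    coeff R (cls R (TypeModule R ν)) (b.sum fun μ c => c • uElt R μ) = b ν := by
  classical
  rw [Finsupp.sum, map_sum, Finset.sum_eq_single ν]
  · rw [map_zsmul, uElt, coeff_basisElt, if_pos rfl, smul_eq_mul, mul_one]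
  · intro μ _ hne
    rw [map_zsmul, uElt, coeff_basisElt, if_neg fun h => hne (cls_typeModule_injective R h),
      smul_zero]
  · intro h
    rw [Finsupp.notMem_support_iff.1 h, zero_smul, map_zero]

/-- The classes `u_μ` form a basis of the Hall algebra. -/
theorem existsUnique_eq_sum_uElt (a : Hall R) :
    ∃! b : YoungDiagram →₀ ℤ, a = b.sum fun μ c => c • uElt R μ := by
  let b : YoungDiagram →₀ ℤ := Finsupp.comapDomain (fun μ => cls R (TypeModule R μ)) a
    (cls_typeModule_injective R).injOn
  have hb : ∀ ν, b ν = coeff R (cls R (TypeModule R ν)) a := fun _ => rfl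
  refine ⟨b, ?_, ?_⟩
  · refine coeff_ext R fun X => ?_
    obtain ⟨ν, rfl⟩ := cls_typeModule_surjective R X
    exact ((coeff_sum_uElt R b ν).trans (hb ν)).symm
  · rintro c rfl
    ext ν
    exact (coeff_sum_uElt R c ν).symm.trans (hb ν).symm

theorem coeff_typeModule_prod_ones (lam μ : YoungDiagram) :
    coeff R (cls R (TypeModule R μ)) (lam.rowLens.map fun r => uElt R (ones r)).prod =
      ∑ A ∈ rowStrictArrays μ lam, (Nat.card (ResidueField R) : ℤ) ^ A.zelevinsky := by
  rw [sum_rowStrictArrays, YoungDiagram.rowLens, List.map_map]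
  refine (coeff_cyclicSum_prod_ones (R := R) lam.rowLen (lam.colLen 0)
    fun i : Fin (μ.colLen 0) => μ.rowLen i).trans (Finset.sum_congr rfl fun T _ => ?_)
  congr

end Classification
end HallAlg

theorem mainTheorem7 (R : Type u) [CommRing R] [IsDomain R] [IsDiscreteValuationRing R]
    [Finite (IsLocalRing.ResidueField R)] (lam : YoungDiagram) :
    (∃! b : YoungDiagram →₀ ℤ,
      (lam.rowLens.map fun r => HallAlg.uElt R (HallAlg.ones r)).prod =
        b.sum fun μ c => c • HallAlg.uElt R μ) ∧
    ∀ b : YoungDiagram →₀ ℤ,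
      (lam.rowLens.map fun r => HallAlg.uElt R (HallAlg.ones r)).prod =
        b.sum (fun μ c => c • HallAlg.uElt R μ) →
      ∀ μ : YoungDiagram, b μ = ∑ A ∈ HallAlg.rowStrictArrays μ lam,
        (Nat.card (IsLocalRing.ResidueField R) : ℤ) ^ A.zelevinsky := by
  refine ⟨HallAlg.existsUnique_eq_sum_uElt R _, fun b hb μ => ?_⟩
  rw [← HallAlg.coeff_typeModule_prod_ones, hb, HallAlg.coeff_sum_uElt]
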